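/- \textbf{Theorem 1 (Bounds on Pairwise Compound Rate).} A BMS channel $W$ has input alphabet $\{0,1\}$, an arbitrary output space, transition densities $W(y\mid x)$ with respect to a $\sigma$-finite reference measure $\mu$, and is symmetric: some $\mu$-preserving involution $\pi$ of the output space satisfies $W(y\mid 1)=W(\pi(y)\mid 0)$ for all $y$. Its capacity $I(W)$ is the maximum, over all input distributions, of the mutual information (in bits) between input and output, and its Bhattacharyya parameter is $Z(W)=\int\sqrt{W(y\mid 0)W(y\mid 1)}\,d\mu(y)$. Let $$W^{0}(y_1,y_2\mid x)=\tfrac12\sum_{a\in\{0,1\}}W(y_1\mid x\oplus a)\,W(y_2\mid a),\qquad W^{1}(y_1,y_2\mid x)=W(y_1\mid x)\,W(y_2\mid x)$$ (check node and variable node). For $\sigma=\sigma_1\cdots\sigma_n\in\{0,1\}^n$ the tree channel of type $\sigma$ is $W^{\sigma}=(\cdots(W^{\sigma_1})^{\sigma_2}\cdots)^{\sigma_n}$, with $W^{\sigma}=W$ for $n=0$. Thus $W^\sigma$ is a complete binary tree of height $n$ with independent observations through $W$ at the leaves, in which all nodes on level $j$ are check nodes if $\sigma_j=0$ and variable nodes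 if $\sigma_j=1$. For $N=2^n$ let $G_n=\bigl[\begin{smallmatrix}1&0\\1&1\end{smallmatrix}\bigr]^{\otimes n}$ over $\mathbb F_2$. The polar code with information set $A\subseteq\{0,\dots,N-1\}$ consists of the words $uG_n$ with $u_i=0$ for $i\notin A$; its rate is $|A|/N$. The successive cancellation (SC) decoder knows the channel $W$ and determines $\hat u_0,\dots,\hat u_{N-1}$ in this order: $\hat u_i=0$ for $i\notin A$, and for $i\in A$ the bit $\hat u_i$ is the value $b$ maximizing $$W_N^{(i)}(y,\hat u_0^{i-1}\mid b)=2^{-(N-1)}\sum_{v:\ v_j=\hat u_j\,(j<i),\ v_i=b}\ \prod_{j=0}^{N-1}W\bigl(y_j\mid (vG_n)_j\bigr),$$ ties being resolved in favour of $0$. The block error probability is the probability that $\hat u\neq u$, for uniformly random information bits. The compound capacity $C_{\text{P,SC}}(P,Q)$ is the supremum of all $R$ such that for every $\varepsilon>0$ there is a polar code of rate at least $R$ whose block error probability under SC decoding is at most $\varepsilon$ on $P$ and also on $Q$. Let $P$ and $Q$ be two BMS channels. Then for every $n\ge 0$ $$1-\frac1{2^n}\sum_{\sigma\in\{0,1\}^n}\max\{Z(P^\sigma),Z(Q^\sigma)\}\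 \le\ C_{\text{P,SC}}(P,Q)\ \le\ \frac1{2^n}\sum_{\sigma\in\{0,1\}^n}\min\{I(P^\sigma),I(Q^\sigma)\}.$$ The upper bound is non-increasing in $n$, the lower bound is non-decreasing in $n$, and both converge to $C_{\text{P,SC}}(P,Q)$ as $n\to\infty$. -/

import Mathlib

open MeasureTheory Filter Topology
open scoped Matrix Kronecker

universe u

/-- A binary-input memoryless output-symmetric (BMS) channel. The input alphabet is `ZMod 2`; the
output space is an arbitrary measurable space; `dens x y` is the transition density `W(y | x)` with
respect to a σ-finite reference measure `ref` (a counting measure for discrete outputs, Lebesgue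
measure for continuous ones, or for instance `W(· | 0) + W(· | 1)` for a general pair of output
laws). Symmetry: an involution of the output space exchanges the two inputs. -/
structure BMS where
  /-- the output space -/
  Out : Type u
  [mOut : MeasurableSpace Out]
  /-- the reference measure on the output space -/
  ref : Measure Out
  [sigmaFinite_ref : SigmaFinite ref]
  /-- the transition density `W(y | x)` -/
  dens : ZMod 2 → Out → ℝ
  measurable_dens : ∀ x, Measurable (dens x)
  dens_nonneg : ∀ x y, 0 ≤ dens x y
  integral_dens : ∀ x, ∫ y, dens x y ∂ref = 1
  symmetric : ∃ π : Out → Out, Function.Involutive π ∧ MeasurePreserving π ref ref ∧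
    ∀ y, dens 1 y = dens 0 (π y)

attribute [instance] BMS.mOut BMS.sigmaFinite_ref

namespace BMS

/-- The law of the channel output when the input is `x`. -/
noncomputable def law (W : BMS.{u}) (x : ZMod 2) : Measure W.Out :=
  W.ref.withDensity fun y => ENNReal.ofReal (W.dens x y)

/-- The mutual information, in bits, between the input and the output of `W` when the input is
`1` with probability `p` and `0` with probability `1 - p`. -/
noncomputable def mutualInfo (W : BMS.{u}) (p : ℝ) : ℝ :=
  ∫ y, ((1 - p) * W.dens 0 y *
        Real.logb 2 (W.dens 0 y / ((1 - p) * W.dens 0 y + p * W.dens 1 y)) +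
      p * W.dens 1 y *
        Real.logb 2 (W.dens 1 y / ((1 - p) * W.dens 0 y + p * W.dens 1 y))) ∂W.ref

/-- The capacity `I(W)`, in bits: the maximal mutual information over all input distributions. -/
noncomputable def capacity (W : BMS.{u}) : ℝ :=
  sSup (W.mutualInfo '' Set.Icc 0 1)

/-- The Bhattacharyya parameter `Z(W)`. -/
noncomputable def bhattacharyya (W : BMS.{u}) : ℝ :=
  ∫ y, Real.sqrt (W.dens 0 y * W.dens 1 y) ∂W.ref

/-! ### Tree channels -/

theorem integrable_dens (W : BMS.{u}) (x : ZMod 2) : Integrable (W.dens x) W.ref :=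
  integrable_of_integral_eq_one (W.integral_dens x)

theorem dens_flip (W : BMS.{u}) : ∃ π : W.Out → W.Out, Function.Involutive π ∧
    MeasurePreserving π W.ref W.ref ∧ ∀ x y, W.dens (x + 1) y = W.dens x (π y) := by
  obtain ⟨π, h1, h2, h3⟩ := W.symmetric
  refine ⟨π, h1, h2, fun x y => ?_⟩
  have h11 : (1 : ZMod 2) + 1 = 0 := by decide
  obtain rfl | rfl : x = 0 ∨ x = 1 := by revert x; decide
  · rw [zero_add]
    exact h3 y
  · rw [h11, h3, h1]

/-- A check node: the bit at the node is the sum of the bits at its two children, which are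
otherwise uniformly distributed; each child is observed through its own independent copy of `W`. -/
noncomputable def check (W : BMS.{u}) : BMS.{u} where
  Out := W.Out × W.Out
  ref := W.ref.prod W.ref
  dens x y := 1 / 2 * ∑ a : ZMod 2, W.dens (x + a) y.1 * W.dens a y.2
  measurable_dens x := by
    refine Measurable.const_mul (Finset.measurable_sum _ fun a _ => ?_) _
    exact ((W.measurable_dens _).comp measurable_fst).mul ((W.measurable_dens _).comp measurable_snd)
  dens_nonneg x y := by
    refine mul_nonneg (by norm_num) (Finset.sum_nonneg fun a _ => ?_)
    exact mul_nonneg (W.dens_nonneg _ _) (W.dens_nonneg _ _)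
  integral_dens x := by
    rw [integral_const_mul, integral_finsetSum _ fun a _ =>
      (W.integrable_dens (x + a)).mul_prod (W.integrable_dens a)]
    simp [integral_prod_mul, W.integral_dens]
  symmetric := by
    obtain ⟨π, h1, h2, h3⟩ := W.dens_flip
    refine ⟨Prod.map π id, fun y => Prod.ext (h1 y.1) rfl, h2.prod (MeasurePreserving.id _),
      fun y => ?_⟩
    congr 1
    refine Finset.sum_congr rfl fun a _ => ?_
    rw [add_comm 1 a, h3, zero_add]
    rfl

/-- A variable node: the bits at its two children are both equal to the bit at the node; each child
is observed through its own independent copy of `W`. -/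
noncomputable def variableNode (W : BMS.{u}) : BMS.{u} where
  Out := W.Out × W.Out
  ref := W.ref.prod W.ref
  dens x y := W.dens x y.1 * W.dens x y.2
  measurable_dens x :=
    ((W.measurable_dens _).comp measurable_fst).mul ((W.measurable_dens _).comp measurable_snd)
  dens_nonneg x y := mul_nonneg (W.dens_nonneg _ _) (W.dens_nonneg _ _)
  integral_dens x := by simp [integral_prod_mul, W.integral_dens]
  symmetric := by
    obtain ⟨π, h1, h2, h3⟩ := W.symmetric
    refine ⟨Prod.map π π, fun y => Prod.ext (h1 y.1) (h1 y.2), h2.prod h2, fun y => ?_⟩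
    rw [h3, h3]
    rfl

/-- The tree channel `W^σ` of type `σ = σ₁ … σₙ`, a complete binary tree of height `n` with
independent observations through `W` at its leaves. All nodes on level `j` (leaves on level `0`,
root on level `n`) are check nodes if `σⱼ = 0` and variable nodes if `σⱼ = 1`; here `σⱼ` is
`σ (j - 1)`, so the root has type `σ (Fin.last n)` in the second clause. -/
noncomputable def tree (W : BMS.{u}) : {n : ℕ} → (Fin n → Fin 2) → BMS.{u}
  | 0, _ => W
  | n + 1, σ =>
    if σ (Fin.last n) = 0 then (W.tree fun j => σ j.castSucc).check
    else (W.tree fun j => σ j.castSucc).variableNode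

end BMS

/-! ### Polar codes and successive cancellation decoding -/

/-- The `n`-th Kronecker power of the matrix `[1 0; 1 1]` over the two-element field. -/
def polarMatrix : (n : ℕ) → Matrix (Fin (2 ^ n)) (Fin (2 ^ n)) (ZMod 2)
  | 0 => 1
  | n + 1 => Matrix.reindex finProdFinEquiv finProdFinEquiv
      (polarMatrix n ⊗ₖ (!![1, 0; 1, 1] : Matrix (Fin 2) (Fin 2) (ZMod 2)))

namespace BMS

/-- The transition density `W_N^{(i)}(y, u₀, …, u_{i-1} | b)`, with `N = 2 ^ n`, of the channel from
the bit `uᵢ = b` to the channel outputs `y` and the previous bits, when `u` is encoded as `u G` with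
`G = polarMatrix n` and all the other bits are uniform. It depends on `u j` for `j < i` only. -/
noncomputable def bitDens (W : BMS.{u}) {n : ℕ} (i : Fin (2 ^ n)) (y : Fin (2 ^ n) → W.Out)
    (u : Fin (2 ^ n) → ZMod 2) (b : ZMod 2) : ℝ :=
  1 / 2 ^ (2 ^ n - 1) *
    ∑ v : Fin (2 ^ n) → ZMod 2 with (∀ j < i, v j = u j) ∧ v i = b,
      ∏ j, W.dens ((v ᵥ* polarMatrix n) j) (y j)

/-- The successive cancellation decoder, with knowledge of the channel `W`, of the polar code with
information set `A`. The bits are decided one by one in the order `0, 1, …, 2 ^ n - 1`; the bits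
outside `A` are frozen to `0`, a bit in `A` is decided by maximum likelihood given the channel
outputs and the previous decisions (in favour of `0` in case of a tie). -/
noncomputable def scDecode (W : BMS.{u}) {n : ℕ} (A : Finset (Fin (2 ^ n)))
    (y : Fin (2 ^ n) → W.Out) (i : Fin (2 ^ n)) : ZMod 2 :=
  let prev : Fin (2 ^ n) → ZMod 2 := fun j => if _h : j < i then W.scDecode A y j else 0
  if i ∈ A then
    if W.bitDens i y prev 1 ≤ W.bitDens i y prev 0 then 0 else 1
  else 0
termination_by i.val
decreasing_by exact _h

/-- The block error probability of the polar code with information set `A` under successive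
cancellation decoding: the information bits are uniform, the bits outside `A` are `0`, the codeword
`u G` is sent over independent uses of `W`, and an error occurs if the decoder does not
recover `u`. -/
noncomputable def blockError (W : BMS.{u}) {n : ℕ} (A : Finset (Fin (2 ^ n))) : ℝ :=
  1 / 2 ^ A.card * ∑ u : Fin (2 ^ n) → ZMod 2 with ∀ i, i ∉ A → u i = 0,
    (Measure.pi fun j => W.law ((u ᵥ* polarMatrix n) j)).real {y | W.scDecode A y ≠ u}

end BMS

/-- The compound capacity `C_{P,SC}` of a collection of BMS channels: the supremum of the rates `R`
such that for every target block error probability `ε > 0` there is a polar code, of some block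
length `2 ^ n` and of rate at least `R`, whose block error probability under successive cancellation
decoding is at most `ε` for every channel of the collection. -/
noncomputable def compoundCapacity (𝒞 : Set BMS.{u}) : ℝ :=
  sSup {R : ℝ | ∀ ε > 0, ∃ (n : ℕ) (A : Finset (Fin (2 ^ n))),
    R ≤ (A.card : ℝ) / 2 ^ n ∧ ∀ W ∈ 𝒞, W.blockError A ≤ ε}

/-!
The two bounds sandwich the compound capacity, and polarization closes the gap between them.

*Single channels.* For a symmetric channel the capacity is the relative entropy of an output law
with respect to the law under uniform input (`BMS.capacity_eq`), which gives the chain rule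
`I(W⁰) + I(W¹) = 2 I(W)` and, through `log x ≤ x - 1`, the linear comparisons
`1 - 3 Z ≤ I ≤ min 1 (3 (1 - Z))`. Sharper ones are not needed. Moreover `Z(W¹) = Z(W)²` and
`Z(W⁰) ≤ 2 Z(W) - Z(W)²`.

*Monotonicity.* By the chain rule the average of `min I` decreases with the height of the tree.
Since `z ↦ 2 z - z²` and `z ↦ z²` are increasing, `max Z` obeys the same recursive bounds as a
single `Z`: it is dominated by the erasure probability of a polarized erasure channel
(`BMS.erasureDominated_maxZ`), and its average decreases as well.

*Codes and tree channels.* The channel from bit `i` to the outputs and the previous bits is the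
tree channel whose type is the binary expansion of `i`, up to a measure-preserving map of the
output space (`BMS.bitChannelIs_tree`). Translation of the outputs by codewords turns probabilities
given a fixed word into averages over all continuations of its first bits (`BMS.wordLaw_bitDens`),
so frozen bits equal to zero are no worse than uniform ones. Hence the block error probability is
at most the sum of `Z` over the information set (`BMS.blockError_le_sum_bhattacharyya`), and
conversely a small block error probability forces every `Z` on the information set to be small
(`BMS.bhattacharyya_le_of_blockError`).

*Achievability.* A process dominated by the erasure probability polarizes: the average of
`2 z - z²` drops in each step by at least the average of `z² (1 - z)²`. Once polarized, the fourth root of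
a small value contracts fast enough for all but a small part of the good types to reach values far
below `2⁻ᴺ` (`ErasureDominated.exists_good_types`). Thus every rate below `1 - avg (max Z)` is
achievable.

*Converse and convergence.* Every bit of a good code sees two tree channels of capacity close to
`1`, and these remain good at every fixed number of further levels; hence `avg (min I)` bounds the
rate. The difference of the two bounds is at most `3 avg (M (1 - M))` with `M = max Z`, which tends
to `0`.
-/

/-! ### The relative entropy integrand -/

/-- The integrand `a log₂ (a / m)` of a relative entropy, in bits. It is `0` for `a = 0`. -/
noncomputable def relEnt (a m : ℝ) : ℝ := a * Real.logb 2 (a / m)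

theorem relEnt_zero_left (m : ℝ) : relEnt 0 m = 0 := by simp [relEnt]

theorem relEnt_le_self {a m : ℝ} (ha : 0 ≤ a) (h : a ≤ 2 * m) :
    relEnt a m ≤ a := by
  rcases ha.eq_or_lt with rfl | ha
  · simp [relEnt]
  have hm' : 0 < m := by linarith
  have : Real.logb 2 (a / m) ≤ 1 := by
    rw [Real.logb_le_iff_le_rpow (by norm_num) (by positivity), Real.rpow_one,
      div_le_iff₀ hm']
    exact h
  calc relEnt a m ≤ a * 1 := mul_le_mul_of_nonneg_left this ha.le
    _ = a := mul_one a

theorem le_relEnt {a m : ℝ} (ha : 0 ≤ a) (hm : 0 ≤ m) (h : m = 0 → a = 0) :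
    (a - m) / Real.log 2 ≤ relEnt a m := by
  have hl : 0 < Real.log 2 := Real.log_pos (by norm_num)
  rcases ha.eq_or_lt with rfl | ha
  · rw [relEnt_zero_left]
    exact div_nonpos_of_nonpos_of_nonneg (by linarith) hl.le
  have hm' : 0 < m := hm.lt_of_ne fun e => ha.ne' (h e.symm)
  rw [relEnt, Real.logb, ← mul_div_assoc]
  refine div_le_div_of_nonneg_right ?_ hl.le
  have h1 := Real.one_sub_inv_le_log_of_pos (x := a / m) (by positivity)
  calc a - m = a * (1 - (a / m)⁻¹) := by field_simp
    _ ≤ a * Real.log (a / m) := mul_le_mul_of_nonneg_left h1 ha.le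

theorem relEnt_le_quadratic {a m : ℝ} (ha : 0 ≤ a) (hm : 0 ≤ m) (h : m = 0 → a = 0) :
    relEnt a m ≤ a * (a - m) / m / Real.log 2 := by
  have hl : 0 < Real.log 2 := Real.log_pos (by norm_num)
  rcases ha.eq_or_lt with rfl | ha
  · simp [relEnt]
  have hm' : 0 < m := hm.lt_of_ne fun e => ha.ne' (h e.symm)
  rw [relEnt, Real.logb, ← mul_div_assoc]
  refine div_le_div_of_nonneg_right ?_ hl.le
  have h1 := Real.log_le_sub_one_of_pos (x := a / m) (by positivity)
  calc a * Real.log (a / m) ≤ a * (a / m - 1) := mul_le_mul_of_nonneg_left h1 ha.le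
    _ = a * (a - m) / m := by field_simp

/-- One term of the bound `1 - h ≥ 1 - const · √(p (1 - p))` on the binary entropy function `h`. -/
theorem sub_le_relEnt {a b : ℝ} (ha : 0 ≤ a) (hb : 0 ≤ b) :
    a - 3 * Real.sqrt (a * b) ≤ relEnt a ((a + b) / 2) := by
  have hl : 0 < Real.log 2 := Real.log_pos (by norm_num)
  rcases ha.eq_or_lt with rfl | ha
  · simp [relEnt]
  have hs := Real.sqrt_nonneg (a * b)
  set r := Real.sqrt (b / a) with hr
  have hr0 : 0 ≤ r := Real.sqrt_nonneg _
  have hrr : r ^ 2 = b / a := Real.sq_sqrt (by positivity)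
  have har : a * r = Real.sqrt (a * b) := by
    have e : a * b = a ^ 2 * (b / a) := by field_simp
    rw [e, Real.sqrt_mul (by positivity), Real.sqrt_sq ha.le]
  -- `log (1 + b / a) ≤ 2 log (1 + √(b / a)) ≤ 2 √(b / a)`
  have h1 : Real.log ((a + b) / a) ≤ 2 * r := by
    have e : (a + b) / a ≤ (1 + r) ^ 2 := by
      have : (a + b) / a = 1 + r ^ 2 := by rw [hrr]; field_simp
      rw [this]
      nlinarith
    calc Real.log ((a + b) / a) ≤ Real.log ((1 + r) ^ 2) :=
          Real.log_le_log (by positivity) e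
      _ = 2 * Real.log (1 + r) := by rw [Real.log_pow]; norm_num
      _ ≤ 2 * r := by
          have := Real.log_le_sub_one_of_pos (x := 1 + r) (by positivity)
          linarith
  have h2 : Real.log (a / ((a + b) / 2)) = Real.log 2 - Real.log ((a + b) / a) := by
    rw [← Real.log_div (by norm_num) (by positivity)]
    congr 1
    field_simp
  have h3 : relEnt a ((a + b) / 2) = a - a * Real.log ((a + b) / a) / Real.log 2 := by
    rw [relEnt, Real.logb, h2]
    field_simp
  have h4 : a * Real.log ((a + b) / a) / Real.log 2 ≤ 3 * Real.sqrt (a * b) := by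
    rw [div_le_iff₀ hl]
    have := Real.log_two_gt_d9
    nlinarith [mul_le_mul_of_nonneg_left h1 ha.le]
  linarith

theorem relEnt_add_relEnt_le {a b : ℝ} (ha : 0 ≤ a) (hb : 0 ≤ b) :
    relEnt a ((a + b) / 2) + relEnt b ((a + b) / 2) ≤
      3 * (a + b - 2 * Real.sqrt (a * b)) := by
  have hm0 : 0 ≤ (a + b) / 2 := by linarith
  have h1 := relEnt_le_quadratic (m := (a + b) / 2) ha hm0 fun h => by linarith
  have h2 := relEnt_le_quadratic (m := (a + b) / 2) hb hm0 fun h => by linarith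
  have hs : a + b - 2 * Real.sqrt (a * b) = (Real.sqrt a - Real.sqrt b) ^ 2 := by
    rw [Real.sqrt_mul ha, sub_sq, Real.sq_sqrt ha, Real.sq_sqrt hb]
    ring
  rw [hs]
  rcases hm0.eq_or_lt with h0 | h0
  · rw [← h0] at h1 h2 ⊢
    simp only [div_zero, zero_div] at h1 h2
    linarith [sq_nonneg (Real.sqrt a - Real.sqrt b)]
  have hl := Real.log_two_gt_d9
  refine (add_le_add h1 h2).trans ?_
  rw [← add_div, ← add_div, div_le_iff₀ (by linarith), div_le_iff₀ h0]
  obtain ⟨x, hx, rfl⟩ : ∃ x, 0 ≤ x ∧ a = x ^ 2 := ⟨_, Real.sqrt_nonneg a, (Real.sq_sqrt ha).symm⟩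
  obtain ⟨y, hy, rfl⟩ : ∃ y, 0 ≤ y ∧ b = y ^ 2 := ⟨_, Real.sqrt_nonneg b, (Real.sq_sqrt hb).symm⟩
  rw [Real.sqrt_sq hx, Real.sqrt_sq hy]
  have e : x ^ 2 * (x ^ 2 - (x ^ 2 + y ^ 2) / 2) + y ^ 2 * (y ^ 2 - (x ^ 2 + y ^ 2) / 2) =
      (x - y) ^ 2 * ((x + y) ^ 2 / 2) := by ring
  rw [e]
  have h3 : (x + y) ^ 2 / 2 ≤ 3 * Real.log 2 * ((x ^ 2 + y ^ 2) / 2) := by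
    nlinarith [sq_nonneg (x - y), sq_nonneg x, sq_nonneg y]
  calc (x - y) ^ 2 * ((x + y) ^ 2 / 2)
      ≤ (x - y) ^ 2 * (3 * Real.log 2 * ((x ^ 2 + y ^ 2) / 2)) :=
        mul_le_mul_of_nonneg_left h3 (sq_nonneg _)
    _ = _ := by ring

theorem relEnt_add_relEnt_chain {x c m : ℝ} (hx : 0 ≤ x) (hc : x ≤ 2 * c) (hm : c ≤ 2 * m) :
    x * Real.logb 2 (c / m) + relEnt x c = relEnt x m := by
  rcases hx.eq_or_lt with rfl | hx
  · simp [relEnt]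
  have hc' : 0 < c := by linarith
  have hm' : 0 < m := by linarith
  rw [relEnt, relEnt, Real.logb_div hc'.ne' hm'.ne', Real.logb_div hx.ne' hc'.ne',
    Real.logb_div hx.ne' hm'.ne']
  ring

theorem relEnt_mul {a c m k : ℝ} (ha : 0 ≤ a) (hc : 0 ≤ c) (hm : a ≤ 2 * m) (hk : c ≤ 2 * k) :
    relEnt (a * c) (m * k) = relEnt a m * c + a * relEnt c k := by
  rcases ha.eq_or_lt with rfl | ha
  · simp [relEnt]
  rcases hc.eq_or_lt with rfl | hc
  · simp [relEnt]
  have hm' : 0 < m := by linarith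
  have hk' : 0 < k := by linarith
  rw [relEnt, relEnt, relEnt, mul_div_mul_comm, Real.logb_mul (by positivity) (by positivity)]
  ring

theorem measurable_relEnt {α : Type*} [MeasurableSpace α] {f g : α → ℝ} (hf : Measurable f)
    (hg : Measurable g) : Measurable fun y => relEnt (f y) (g y) :=
  hf.mul ((Real.measurable_log.comp (hf.div hg)).div_const _)

theorem integrable_relEnt {α : Type*} [MeasurableSpace α] {μ : Measure α} {f g : α → ℝ}
    (hf : Measurable f) (hg : Measurable g) (hfi : Integrable f μ) (hgi : Integrable g μ)
    (hf0 : ∀ y, 0 ≤ f y) (hfg : ∀ y, f y ≤ 2 * g y) :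
    Integrable (fun y => relEnt (f y) (g y)) μ := by
  have hl : 0 < Real.log 2 := Real.log_pos (by norm_num)
  refine (hfi.add (hgi.div_const (Real.log 2))).mono'
    (measurable_relEnt hf hg).aestronglyMeasurable (Eventually.of_forall fun y => ?_)
  have hf := hf0 y
  have hg : 0 ≤ g y := by linarith [hfg y]
  have h1 := relEnt_le_self hf (hfg y)
  have h2 := le_relEnt hf hg fun h => by linarith [hfg y]
  have h3 : 0 ≤ f y / Real.log 2 := by positivity
  have h4 : 0 ≤ g y / Real.log 2 := by positivity
  rw [sub_div] at h2
  rw [Real.norm_eq_abs, abs_le]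
  simp only [Pi.add_apply]
  constructor <;> linarith

namespace BMS

/-! ### Capacity of a symmetric channel -/

/-- The output density of `W` under uniform input. -/
noncomputable def mean (W : BMS.{u}) (y : W.Out) : ℝ := (W.dens 0 y + W.dens 1 y) / 2

theorem zmod_two_cases (x : ZMod 2) : x = 0 ∨ x = 1 := by revert x; decide

theorem measurable_mean (W : BMS.{u}) : Measurable W.mean :=
  ((W.measurable_dens 0).add (W.measurable_dens 1)).div_const 2

theorem integrable_mean (W : BMS.{u}) : Integrable W.mean W.ref :=
  ((W.integrable_dens 0).add (W.integrable_dens 1)).div_const 2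

theorem integral_mean (W : BMS.{u}) : ∫ y, W.mean y ∂W.ref = 1 := by
  unfold mean
  rw [integral_div, integral_add (W.integrable_dens 0) (W.integrable_dens 1), W.integral_dens,
    W.integral_dens]
  norm_num

theorem mean_nonneg (W : BMS.{u}) (y : W.Out) : 0 ≤ W.mean y := by
  have h0 := W.dens_nonneg 0 y
  have h1 := W.dens_nonneg 1 y
  unfold mean
  linarith

theorem dens_le_two_mul_mean (W : BMS.{u}) (x : ZMod 2) (y : W.Out) :
    W.dens x y ≤ 2 * W.mean y := by
  have h0 := W.dens_nonneg 0 y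
  have h1 := W.dens_nonneg 1 y
  unfold mean
  obtain rfl | rfl := zmod_two_cases x <;> linarith

theorem integrable_relEnt_mean (W : BMS.{u}) (x : ZMod 2) :
    Integrable (fun y => relEnt (W.dens x y) (W.mean y)) W.ref :=
  integrable_relEnt (W.measurable_dens x) W.measurable_mean (W.integrable_dens x)
    W.integrable_mean (W.dens_nonneg x) (W.dens_le_two_mul_mean x)

/-- The symmetry of a channel as an action of the input group: `f c` sends the law of the output for
input `x + c` to that for input `x`. -/
theorem exists_flip (W : BMS.{u}) : ∃ f : ZMod 2 → W.Out → W.Out,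
    (∀ c, MeasurePreserving (f c) W.ref W.ref) ∧ ∀ x c y, W.dens (x + c) y = W.dens x (f c y) := by
  obtain ⟨π, -, h2, h3⟩ := W.dens_flip
  refine ⟨fun c => if c = 0 then id else π, fun c => ?_, fun x c y => ?_⟩
  · dsimp only
    split_ifs
    · exact MeasurePreserving.id _
    · exact h2
  · obtain rfl | rfl := zmod_two_cases c
    · simp
    · simp [h3]

theorem integral_relEnt_symm (W : BMS.{u}) :
    ∫ y, relEnt (W.dens 1 y) (W.mean y) ∂W.ref = ∫ y, relEnt (W.dens 0 y) (W.mean y) ∂W.ref := by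
  obtain ⟨π, -, h2, h3⟩ := W.dens_flip
  have e : ∀ y, relEnt (W.dens 1 y) (W.mean y) = relEnt (W.dens 0 (π y)) (W.mean (π y)) := by
    intro y
    have h11 : (1 : ZMod 2) + 1 = 0 := by decide
    simp only [mean, ← h3, h11, zero_add, add_comm (W.dens 1 y)]
  simp_rw [e]
  conv_rhs => rw [← h2.map_eq]
  rw [integral_map h2.measurable.aemeasurable
    (measurable_relEnt (W.measurable_dens 0) W.measurable_mean).aestronglyMeasurable]

/-- Cross-entropy comparison: replacing the true output density by the uniform-input one can only
increase the value, the correction `(m - q) / log 2` having integral zero. -/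
theorem mutualInfo_integrand_le {p a b : ℝ} (hp0 : 0 ≤ p) (hp1 : p ≤ 1) (ha : 0 ≤ a)
    (hb : 0 ≤ b) :
    (1 - p) * a * Real.logb 2 (a / ((1 - p) * a + p * b)) +
        p * b * Real.logb 2 (b / ((1 - p) * a + p * b)) ≤
      (1 - p) * relEnt a ((a + b) / 2) + p * relEnt b ((a + b) / 2) +
        ((a + b) / 2 - ((1 - p) * a + p * b)) / Real.log 2 := by
  have hp1' : 0 ≤ 1 - p := by linarith
  have hpa : 0 ≤ (1 - p) * a := by positivity
  have hpb : 0 ≤ p * b := by positivity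
  set q := (1 - p) * a + p * b with hq
  have hq0 : 0 ≤ q := by positivity
  have hm0 : 0 ≤ (a + b) / 2 := by linarith
  have key : ∀ t c : ℝ, 0 ≤ t → 0 ≤ c → t * c ≤ q → c ≤ a + b →
      t * c * Real.logb 2 (c / q) =
        t * relEnt c ((a + b) / 2) - t * c * Real.logb 2 (q / ((a + b) / 2)) := by
    intro t c ht hc hcq hcm
    rcases (mul_nonneg ht hc).eq_or_lt with h | h
    · rw [relEnt, ← mul_assoc, ← h]
      simp
    · have hc' : 0 < c := hc.lt_of_ne fun e => by simp [← e] at h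
      have hq' : 0 < q := by linarith
      have hm' : 0 < (a + b) / 2 := by linarith
      rw [relEnt, Real.logb_div hc'.ne' hq'.ne', Real.logb_div hc'.ne' hm'.ne',
        Real.logb_div hq'.ne' hm'.ne']
      ring
  rw [key (1 - p) a hp1' ha (by linarith) (by linarith), key p b hp0 hb (by linarith) (by linarith)]
  have h := le_relEnt hq0 hm0 fun h => by
    have : a = 0 := by linarith
    have : b = 0 := by linarith
    simp [*]
  have e : relEnt q ((a + b) / 2) = (1 - p) * a * Real.logb 2 (q / ((a + b) / 2)) +
      p * b * Real.logb 2 (q / ((a + b) / 2)) := by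
    rw [relEnt]
    nth_rewrite 1 [hq]
    ring
  rw [e] at h
  rw [sub_div] at h ⊢
  linarith

theorem mutualInfo_half (W : BMS.{u}) :
    W.mutualInfo (1 / 2) = ∫ y, relEnt (W.dens 0 y) (W.mean y) ∂W.ref := by
  have e : ∀ y, (1 - 1 / 2) * W.dens 0 y *
        Real.logb 2 (W.dens 0 y / ((1 - 1 / 2) * W.dens 0 y + 1 / 2 * W.dens 1 y)) +
      1 / 2 * W.dens 1 y *
        Real.logb 2 (W.dens 1 y / ((1 - 1 / 2) * W.dens 0 y + 1 / 2 * W.dens 1 y)) =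
      1 / 2 * relEnt (W.dens 0 y) (W.mean y) + 1 / 2 * relEnt (W.dens 1 y) (W.mean y) := by
    intro y
    have : (1 - 1 / 2) * W.dens 0 y + 1 / 2 * W.dens 1 y = W.mean y := by unfold mean; ring
    rw [this, relEnt, relEnt]
    ring
  rw [mutualInfo]
  simp_rw [e]
  rw [integral_add ((W.integrable_relEnt_mean 0).const_mul _)
    ((W.integrable_relEnt_mean 1).const_mul _), integral_const_mul, integral_const_mul,
    W.integral_relEnt_symm]
  ring

theorem mutualInfo_half_nonneg (W : BMS.{u}) : 0 ≤ W.mutualInfo (1 / 2) := by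
  have h : ∫ y, (W.dens 0 y - W.mean y) / Real.log 2 ∂W.ref ≤
      ∫ y, relEnt (W.dens 0 y) (W.mean y) ∂W.ref := by
    refine integral_mono (((W.integrable_dens 0).sub W.integrable_mean).div_const _)
      (W.integrable_relEnt_mean 0) fun y => ?_
    exact le_relEnt (W.dens_nonneg 0 y) (W.mean_nonneg y) fun h => by
      linarith [W.dens_le_two_mul_mean 0 y, W.dens_nonneg 0 y]
  rw [integral_div, integral_sub (W.integrable_dens 0) W.integrable_mean, W.integral_dens,
    W.integral_mean, sub_self, zero_div] at h
  rwa [mutualInfo_half]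

theorem mutualInfo_le_half (W : BMS.{u}) {p : ℝ} (hp0 : 0 ≤ p) (hp1 : p ≤ 1) :
    W.mutualInfo p ≤ W.mutualInfo (1 / 2) := by
  by_cases hi : Integrable (fun y => (1 - p) * W.dens 0 y *
        Real.logb 2 (W.dens 0 y / ((1 - p) * W.dens 0 y + p * W.dens 1 y)) +
      p * W.dens 1 y *
        Real.logb 2 (W.dens 1 y / ((1 - p) * W.dens 0 y + p * W.dens 1 y))) W.ref
  · have i0 := (W.integrable_relEnt_mean 0).const_mul (1 - p)
    have i1 := (W.integrable_relEnt_mean 1).const_mul p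
    have i2 := ((W.integrable_dens 0).const_mul (1 - p)).add ((W.integrable_dens 1).const_mul p)
    have i3 := (W.integrable_mean.sub i2).div_const (Real.log 2)
    have h := integral_mono hi ((i0.add i1).add i3) fun y =>
      mutualInfo_integrand_le hp0 hp1 (W.dens_nonneg 0 y) (W.dens_nonneg 1 y)
    refine h.trans_eq ?_
    rw [integral_add' (i0.add i1) i3, integral_add' i0 i1, integral_const_mul, integral_const_mul,
      W.integral_relEnt_symm, mutualInfo_half, integral_div, integral_sub' W.integrable_mean i2,
      integral_add' ((W.integrable_dens 0).const_mul (1 - p)) ((W.integrable_dens 1).const_mul p),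
      integral_const_mul, integral_const_mul, W.integral_dens, W.integral_dens, W.integral_mean]
    ring
  · -- this case does not occur, but the comparison with the nonnegative right side covers it
    rw [mutualInfo, integral_undef hi]
    exact W.mutualInfo_half_nonneg

/-- The capacity of a symmetric channel is attained by the uniform input, and it is the relative
entropy of the output law for input `0` with respect to the law for a uniform input. -/
theorem capacity_eq (W : BMS.{u}) :
    W.capacity = ∫ y, relEnt (W.dens 0 y) (W.mean y) ∂W.ref := by
  rw [← mutualInfo_half]
  refine IsGreatest.csSup_eq ⟨⟨1 / 2, by norm_num, rfl⟩, ?_⟩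
  rintro _ ⟨p, hp, rfl⟩
  exact W.mutualInfo_le_half hp.1 hp.2

theorem capacity_eq' (W : BMS.{u}) (x : ZMod 2) :
    W.capacity = ∫ y, relEnt (W.dens x y) (W.mean y) ∂W.ref := by
  obtain rfl | rfl := zmod_two_cases x
  · exact W.capacity_eq
  · rw [integral_relEnt_symm, capacity_eq]

theorem capacity_nonneg (W : BMS.{u}) : 0 ≤ W.capacity := by
  rw [capacity_eq, ← mutualInfo_half]
  exact W.mutualInfo_half_nonneg

theorem capacity_le_one (W : BMS.{u}) : W.capacity ≤ 1 := by
  rw [capacity_eq, ← W.integral_dens 0]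
  exact integral_mono (W.integrable_relEnt_mean 0) (W.integrable_dens 0) fun y =>
    relEnt_le_self (W.dens_nonneg 0 y) (W.dens_le_two_mul_mean 0 y)

/-! ### The Bhattacharyya parameter -/

theorem sqrt_mul_le_half_add {a b : ℝ} (ha : 0 ≤ a) (hb : 0 ≤ b) :
    Real.sqrt (a * b) ≤ (a + b) / 2 := by
  refine Real.sqrt_le_iff.2 ⟨by linarith, ?_⟩
  nlinarith [sq_nonneg (a - b)]

theorem integrable_sqrt_dens (W : BMS.{u}) :
    Integrable (fun y => Real.sqrt (W.dens 0 y * W.dens 1 y)) W.ref := by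
  refine W.integrable_mean.mono'
    ((W.measurable_dens 0).mul (W.measurable_dens 1)).sqrt.aestronglyMeasurable
    (Eventually.of_forall fun y => ?_)
  rw [Real.norm_eq_abs, abs_of_nonneg (Real.sqrt_nonneg _)]
  exact sqrt_mul_le_half_add (W.dens_nonneg 0 y) (W.dens_nonneg 1 y)

theorem bhattacharyya_nonneg (W : BMS.{u}) : 0 ≤ W.bhattacharyya :=
  integral_nonneg fun _ => Real.sqrt_nonneg _

theorem bhattacharyya_le_one (W : BMS.{u}) : W.bhattacharyya ≤ 1 := by
  rw [← W.integral_mean]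
  exact integral_mono W.integrable_sqrt_dens W.integrable_mean fun y =>
    sqrt_mul_le_half_add (W.dens_nonneg 0 y) (W.dens_nonneg 1 y)

theorem bhattacharyya_variableNode (W : BMS.{u}) :
    W.variableNode.bhattacharyya = W.bhattacharyya ^ 2 := by
  have e : ∀ y : W.Out × W.Out, Real.sqrt (W.dens 0 y.1 * W.dens 0 y.2 *
      (W.dens 1 y.1 * W.dens 1 y.2)) =
      Real.sqrt (W.dens 0 y.1 * W.dens 1 y.1) * Real.sqrt (W.dens 0 y.2 * W.dens 1 y.2) := by
    intro y
    rw [← Real.sqrt_mul (mul_nonneg (W.dens_nonneg _ _) (W.dens_nonneg _ _))]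
    congr 1
    ring
  change ∫ y : W.Out × W.Out, Real.sqrt (W.dens 0 y.1 * W.dens 0 y.2 *
      (W.dens 1 y.1 * W.dens 1 y.2)) ∂(W.ref.prod W.ref) = _
  simp_rw [e]
  rw [integral_prod_mul (μ := W.ref) (ν := W.ref) (fun y => Real.sqrt (W.dens 0 y * W.dens 1 y))
    (fun y => Real.sqrt (W.dens 0 y * W.dens 1 y)), sq]
  rfl

theorem sum_zmod_two {M : Type*} [AddCommMonoid M] (f : ZMod 2 → M) :
    ∑ a : ZMod 2, f a = f 0 + f 1 :=
  Fin.sum_univ_two f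

theorem check_dens_zero (W : BMS.{u}) (y : W.Out × W.Out) : W.check.dens 0 y =
    1 / 2 * (W.dens 0 y.1 * W.dens 0 y.2 + W.dens 1 y.1 * W.dens 1 y.2) := by
  change 1 / 2 * ∑ a : ZMod 2, W.dens (0 + a) y.1 * W.dens a y.2 = _
  rw [sum_zmod_two, zero_add, zero_add]

theorem check_dens_one (W : BMS.{u}) (y : W.Out × W.Out) : W.check.dens 1 y =
    1 / 2 * (W.dens 1 y.1 * W.dens 0 y.2 + W.dens 0 y.1 * W.dens 1 y.2) := by
  have h11 : (1 : ZMod 2) + 1 = 0 := by decide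
  change 1 / 2 * ∑ a : ZMod 2, W.dens (1 + a) y.1 * W.dens a y.2 = _
  rw [sum_zmod_two, h11, add_zero]

/-- The squares of the two sides differ by `√(abcd) (√a - √b)² (√c - √d)² / 2`. -/
theorem sqrt_check_le {a b c d : ℝ} (ha : 0 ≤ a) (hb : 0 ≤ b) (hc : 0 ≤ c) (hd : 0 ≤ d) :
    Real.sqrt (1 / 2 * (a * c + b * d) * (1 / 2 * (b * c + a * d))) ≤
      (a + b) / 2 * Real.sqrt (c * d) + Real.sqrt (a * b) * ((c + d) / 2) -
        Real.sqrt (a * b) * Real.sqrt (c * d) := by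
  obtain ⟨a, ha', rfl⟩ : ∃ x, 0 ≤ x ∧ a = x ^ 2 := ⟨_, Real.sqrt_nonneg a, (Real.sq_sqrt ha).symm⟩
  obtain ⟨b, hb', rfl⟩ : ∃ x, 0 ≤ x ∧ b = x ^ 2 := ⟨_, Real.sqrt_nonneg b, (Real.sq_sqrt hb).symm⟩
  obtain ⟨c, hc', rfl⟩ : ∃ x, 0 ≤ x ∧ c = x ^ 2 := ⟨_, Real.sqrt_nonneg c, (Real.sq_sqrt hc).symm⟩
  obtain ⟨d, hd', rfl⟩ : ∃ x, 0 ≤ x ∧ d = x ^ 2 := ⟨_, Real.sqrt_nonneg d, (Real.sq_sqrt hd).symm⟩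
  rw [← mul_pow a b, ← mul_pow c d, Real.sqrt_sq (mul_nonneg ha' hb'),
    Real.sqrt_sq (mul_nonneg hc' hd')]
  refine Real.sqrt_le_iff.2 ⟨?_, ?_⟩
  · have h1 : 0 ≤ c * d * (a - b) ^ 2 := by positivity
    have h2 : 0 ≤ a * b * (c ^ 2 + d ^ 2) := by positivity
    nlinarith
  · have h : 0 ≤ a * b * (c * d) * ((a - b) ^ 2 * (c - d) ^ 2) := by positivity
    nlinarith

theorem bhattacharyya_check_le (W : BMS.{u}) :
    W.check.bhattacharyya ≤ 2 * W.bhattacharyya - W.bhattacharyya ^ 2 := by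
  have i1 := W.integrable_mean.mul_prod W.integrable_sqrt_dens
  have i2 := W.integrable_sqrt_dens.mul_prod W.integrable_mean
  have i3 := W.integrable_sqrt_dens.mul_prod W.integrable_sqrt_dens
  have hp : ∀ y : W.Out × W.Out, Real.sqrt (W.check.dens 0 y * W.check.dens 1 y) ≤
      W.mean y.1 * Real.sqrt (W.dens 0 y.2 * W.dens 1 y.2) +
        Real.sqrt (W.dens 0 y.1 * W.dens 1 y.1) * W.mean y.2 -
        Real.sqrt (W.dens 0 y.1 * W.dens 1 y.1) * Real.sqrt (W.dens 0 y.2 * W.dens 1 y.2) := by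
    intro y
    rw [check_dens_zero, check_dens_one]
    exact sqrt_check_le (W.dens_nonneg 0 y.1) (W.dens_nonneg 1 y.1) (W.dens_nonneg 0 y.2)
      (W.dens_nonneg 1 y.2)
  have h : W.check.bhattacharyya ≤ _ :=
    integral_mono W.check.integrable_sqrt_dens ((i1.add i2).sub i3) hp
  refine h.trans_eq ?_
  refine (integral_sub' (i1.add i2) i3).trans ?_
  rw [integral_add' i1 i2,
    integral_prod_mul W.mean fun y => Real.sqrt (W.dens 0 y * W.dens 1 y),
    integral_prod_mul (fun y => Real.sqrt (W.dens 0 y * W.dens 1 y)) W.mean,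
    integral_prod_mul (fun y => Real.sqrt (W.dens 0 y * W.dens 1 y))
      fun y => Real.sqrt (W.dens 0 y * W.dens 1 y), W.integral_mean]
  unfold bhattacharyya
  ring

theorem one_sub_three_mul_bhattacharyya_le_capacity (W : BMS.{u}) :
    1 - 3 * W.bhattacharyya ≤ W.capacity := by
  have h : ∫ y, (W.dens 0 y - 3 * Real.sqrt (W.dens 0 y * W.dens 1 y)) ∂W.ref ≤ _ :=
    integral_mono ((W.integrable_dens 0).sub (W.integrable_sqrt_dens.const_mul 3))
      (W.integrable_relEnt_mean 0) fun y => sub_le_relEnt (W.dens_nonneg 0 y) (W.dens_nonneg 1 y)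
  rw [integral_sub (W.integrable_dens 0) (W.integrable_sqrt_dens.const_mul 3), integral_const_mul,
    W.integral_dens] at h
  rw [capacity_eq]
  exact h

theorem capacity_le_three_mul (W : BMS.{u}) : W.capacity ≤ 3 * (1 - W.bhattacharyya) := by
  have i0 := W.integrable_relEnt_mean 0
  have i1 := W.integrable_relEnt_mean 1
  have i2 := (W.integrable_dens 0).add (W.integrable_dens 1)
  have i3 := W.integrable_sqrt_dens.const_mul 2
  have h := integral_mono (i0.add i1) ((i2.sub i3).const_mul 3) fun y =>
    relEnt_add_relEnt_le (W.dens_nonneg 0 y) (W.dens_nonneg 1 y)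
  rw [integral_add' i0 i1, integral_const_mul, integral_sub' i2 i3, integral_const_mul,
    integral_add' (W.integrable_dens 0) (W.integrable_dens 1), W.integral_dens, W.integral_dens,
    ← capacity_eq', ← capacity_eq'] at h
  unfold bhattacharyya
  linarith

/-! ### The chain rule -/

theorem check_mean (W : BMS.{u}) (y : W.Out × W.Out) :
    W.check.mean y = W.mean y.1 * W.mean y.2 := by
  change (W.check.dens 0 y + W.check.dens 1 y) / 2 = _
  rw [check_dens_zero, check_dens_one, mean, mean]
  ring

theorem variableNode_dens (W : BMS.{u}) (x : ZMod 2) (y : W.Out × W.Out) :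
    W.variableNode.dens x y = W.dens x y.1 * W.dens x y.2 := rfl

/-- Uniform input to a variable node produces the output law of a check node with input `0`. -/
theorem variableNode_mean (W : BMS.{u}) (y : W.Out × W.Out) :
    W.variableNode.mean y = W.check.dens 0 y := by
  rw [check_dens_zero]
  change (W.dens 0 y.1 * W.dens 0 y.2 + W.dens 1 y.1 * W.dens 1 y.2) / 2 = _
  ring

/-- Pointwise form of the chain rule. -/
theorem relEnt_check_add_relEnt_variableNode (W : BMS.{u}) (y : W.Out × W.Out) :
    relEnt (W.check.dens 0 y) (W.check.mean y) +
        (1 / 2 * relEnt (W.variableNode.dens 0 y) (W.variableNode.mean y) +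
          1 / 2 * relEnt (W.variableNode.dens 1 y) (W.variableNode.mean y)) =
      1 / 2 * ((relEnt (W.dens 0 y.1) (W.mean y.1) * W.dens 0 y.2 +
          W.dens 0 y.1 * relEnt (W.dens 0 y.2) (W.mean y.2)) +
        (relEnt (W.dens 1 y.1) (W.mean y.1) * W.dens 1 y.2 +
          W.dens 1 y.1 * relEnt (W.dens 1 y.2) (W.mean y.2))) := by
  have hc : W.check.dens 0 y ≤ 2 * W.check.mean y := W.check.dens_le_two_mul_mean 0 y
  have hv : ∀ x, relEnt (W.dens x y.1) (W.mean y.1) * W.dens x y.2 +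
      W.dens x y.1 * relEnt (W.dens x y.2) (W.mean y.2) =
      W.variableNode.dens x y * Real.logb 2 (W.check.dens 0 y / W.check.mean y) +
        relEnt (W.variableNode.dens x y) (W.variableNode.mean y) := by
    intro x
    rw [← relEnt_mul (W.dens_nonneg x _) (W.dens_nonneg x _) (W.dens_le_two_mul_mean x _)
      (W.dens_le_two_mul_mean x _), ← check_mean, ← variableNode_dens, variableNode_mean]
    refine (relEnt_add_relEnt_chain (W.variableNode.dens_nonneg x y) ?_ hc).symm
    rw [← variableNode_mean]
    exact W.variableNode.dens_le_two_mul_mean x y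
  have e : relEnt (W.check.dens 0 y) (W.check.mean y) =
      1 / 2 * (W.variableNode.dens 0 y * Real.logb 2 (W.check.dens 0 y / W.check.mean y) +
        W.variableNode.dens 1 y * Real.logb 2 (W.check.dens 0 y / W.check.mean y)) := by
    rw [relEnt, variableNode_dens, variableNode_dens]
    nth_rewrite 1 [check_dens_zero]
    ring
  rw [hv, hv, e]
  ring

/-- Chain rule for the mutual information: the check node channel sees the sum of the two inputs of
a pair of independent uses of `W`, the variable node channel the second input given that sum. -/
theorem capacity_check_add_capacity_variableNode (W : BMS.{u}) :
    W.check.capacity + W.variableNode.capacity = 2 * W.capacity := by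
  have ic : Integrable (fun y : W.Out × W.Out => relEnt (W.check.dens 0 y) (W.check.mean y))
      (W.ref.prod W.ref) := W.check.integrable_relEnt_mean 0
  have iv : ∀ x, Integrable (fun y : W.Out × W.Out =>
      1 / 2 * relEnt (W.variableNode.dens x y) (W.variableNode.mean y)) (W.ref.prod W.ref) :=
    fun x => (W.variableNode.integrable_relEnt_mean x).const_mul (1 / 2)
  have hc : ∫ y : W.Out × W.Out, relEnt (W.check.dens 0 y) (W.check.mean y) ∂(W.ref.prod W.ref) =
    W.check.capacity := W.check.capacity_eq.symm
  have hv : ∀ x, ∫ y : W.Out × W.Out, 1 / 2 * relEnt (W.variableNode.dens x y)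
      (W.variableNode.mean y) ∂(W.ref.prod W.ref) = 1 / 2 * W.variableNode.capacity := fun x =>
    (integral_const_mul _ _).trans (congrArg (1 / 2 * ·) (W.variableNode.capacity_eq' x).symm)
  have hL := integral_add ic ((iv 0).add (iv 1))
  have hL' := integral_add (iv 0) (iv 1)
  simp only [Pi.add_apply] at hL
  rw [hL', hc, hv, hv] at hL
  simp_rw [relEnt_check_add_relEnt_variableNode] at hL
  have j := W.integrable_relEnt_mean
  have k := W.integrable_dens
  have a : ∀ x, Integrable (fun y : W.Out × W.Out =>
      relEnt (W.dens x y.1) (W.mean y.1) * W.dens x y.2) (W.ref.prod W.ref) :=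
    fun x => (j x).mul_prod (k x)
  have b : ∀ x, Integrable (fun y : W.Out × W.Out =>
      W.dens x y.1 * relEnt (W.dens x y.2) (W.mean y.2)) (W.ref.prod W.ref) :=
    fun x => (k x).mul_prod (j x)
  have ha : ∀ x, ∫ y : W.Out × W.Out, relEnt (W.dens x y.1) (W.mean y.1) * W.dens x y.2
      ∂(W.ref.prod W.ref) = W.capacity := fun x => by
    rw [integral_prod_mul (fun y => relEnt (W.dens x y) (W.mean y)) (W.dens x), W.integral_dens,
      mul_one, ← capacity_eq']
  have hb : ∀ x, ∫ y : W.Out × W.Out, W.dens x y.1 * relEnt (W.dens x y.2) (W.mean y.2)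
      ∂(W.ref.prod W.ref) = W.capacity := fun x => by
    rw [integral_prod_mul (W.dens x) fun y => relEnt (W.dens x y) (W.mean y), W.integral_dens,
      one_mul, ← capacity_eq']
  rw [integral_const_mul] at hL
  have hR := integral_add ((a 0).add (b 0)) ((a 1).add (b 1))
  simp only [Pi.add_apply] at hR
  rw [hR, integral_add (a 0) (b 0), integral_add (a 1) (b 1), ha, ha, hb, hb] at hL
  linarith

end BMS

/-! ### The polar transform, one step at a time -/

/-- The binary digits of an index `i < 2 ^ n`, the most significant one first: this is the type of
the tree channel seen by the bit with index `i`. -/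
def bits : (n : ℕ) → Fin (2 ^ n) ≃ (Fin n → Fin 2)
  | 0 => Equiv.ofUnique (Fin 1) _
  | n + 1 => (finProdFinEquiv (m := 2 ^ n) (n := 2)).symm.trans
      (((bits n).prodCongr (Equiv.refl _)).trans
        ((Equiv.prodComm _ _).trans (Fin.snocEquiv fun _ => Fin 2)))

/-- The index `2 k + x` of length `n + 1`. -/
def childIdx {n : ℕ} (k : Fin (2 ^ n)) (x : Fin 2) : Fin (2 ^ (n + 1)) :=
  finProdFinEquiv (k, x)

theorem childIdx_val {n : ℕ} (k : Fin (2 ^ n)) (x : Fin 2) :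
    (childIdx k x : ℕ) = x + 2 * k := rfl

theorem exists_childIdx {n : ℕ} (i : Fin (2 ^ (n + 1))) : ∃ k x, i = childIdx k x :=
  ⟨_, _, ((finProdFinEquiv (m := 2 ^ n) (n := 2)).apply_symm_apply i).symm⟩

theorem bits_childIdx {n : ℕ} (k : Fin (2 ^ n)) (x : Fin 2) :
    bits (n + 1) (childIdx k x) = Fin.snoc (bits n k) x := by
  change Fin.snocEquiv (fun _ => Fin 2) (Equiv.prodComm _ _ (((bits n).prodCongr (Equiv.refl _))
    ((finProdFinEquiv (m := 2 ^ n) (n := 2)).symm (finProdFinEquiv (k, x))))) = _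
  rw [Equiv.symm_apply_apply]
  rfl

theorem prod_childIdx {M : Type*} [CommMonoid M] {n : ℕ} (f : Fin (2 ^ (n + 1)) → M) :
    ∏ i, f i = (∏ k, f (childIdx k 0)) * ∏ k, f (childIdx k 1) := by
  rw [← Finset.prod_mul_distrib]
  refine (Fintype.prod_equiv (finProdFinEquiv (m := 2 ^ n) (n := 2))
    (fun p => f (childIdx p.1 p.2)) f fun _ => rfl).symm.trans ?_
  rw [Fintype.prod_prod_type]
  exact Finset.prod_congr rfl fun k _ => Fin.prod_univ_two _

theorem sum_childIdx {M : Type*} [AddCommMonoid M] {n : ℕ} (f : Fin (2 ^ (n + 1)) → M) :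
    ∑ i, f i = (∑ k, f (childIdx k 0)) + ∑ k, f (childIdx k 1) := by
  rw [← Finset.sum_add_distrib]
  refine (Fintype.sum_equiv (finProdFinEquiv (m := 2 ^ n) (n := 2))
    (fun p => f (childIdx p.1 p.2)) f fun _ => rfl).symm.trans ?_
  rw [Fintype.sum_prod_type]
  exact Finset.sum_congr rfl fun k _ => Fin.sum_univ_two _

/-- The information word of the even half of the codeword of `v`. -/
def sumHalf {n : ℕ} (v : Fin (2 ^ (n + 1)) → ZMod 2) (k : Fin (2 ^ n)) : ZMod 2 :=
  v (childIdx k 0) + v (childIdx k 1)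

/-- The information word of the odd half of the codeword of `v`. -/
def oddHalf {n : ℕ} (v : Fin (2 ^ (n + 1)) → ZMod 2) (k : Fin (2 ^ n)) : ZMod 2 :=
  v (childIdx k 1)

theorem polarMatrix_childIdx {n : ℕ} (k l : Fin (2 ^ n)) (x y : Fin 2) :
    polarMatrix (n + 1) (childIdx k x) (childIdx l y) =
      polarMatrix n k l * (!![1, 0; 1, 1] : Matrix (Fin 2) (Fin 2) (ZMod 2)) x y := by
  change (polarMatrix n ⊗ₖ (!![1, 0; 1, 1] : Matrix (Fin 2) (Fin 2) (ZMod 2)))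
    (finProdFinEquiv.symm (finProdFinEquiv (k, x)))
    (finProdFinEquiv.symm (finProdFinEquiv (l, y))) = _
  rw [Equiv.symm_apply_apply, Equiv.symm_apply_apply]
  rfl

theorem vecMul_polarMatrix_zero {n : ℕ} (v : Fin (2 ^ (n + 1)) → ZMod 2) (l : Fin (2 ^ n)) :
    (v ᵥ* polarMatrix (n + 1)) (childIdx l 0) = (sumHalf v ᵥ* polarMatrix n) l := by
  simp only [Matrix.vecMul, dotProduct, sum_childIdx, polarMatrix_childIdx, sumHalf]
  simp [add_mul, Finset.sum_add_distrib]

theorem vecMul_polarMatrix_one {n : ℕ} (v : Fin (2 ^ (n + 1)) → ZMod 2) (l : Fin (2 ^ n)) :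
    (v ᵥ* polarMatrix (n + 1)) (childIdx l 1) = (oddHalf v ᵥ* polarMatrix n) l := by
  simp only [Matrix.vecMul, dotProduct, sum_childIdx, polarMatrix_childIdx, oddHalf]
  simp

theorem zmod_two_add_self (x : ZMod 2) : x + x = 0 := by revert x; decide

theorem zmod_two_add_eq_iff (a b c : ZMod 2) : a + b = c ↔ a = c + b := by revert a b c; decide

/-- A word of length `2 ^ (n + 1)` is determined by the information words of the two halves of its
codeword, which are arbitrary. -/
def halvesEquiv (n : ℕ) : (Fin (2 ^ (n + 1)) → ZMod 2) ≃
    (Fin (2 ^ n) → ZMod 2) × (Fin (2 ^ n) → ZMod 2) where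
  toFun v := (sumHalf v, oddHalf v)
  invFun p i :=
    let kx := (finProdFinEquiv (m := 2 ^ n) (n := 2)).symm i
    if kx.2 = 0 then p.1 kx.1 + p.2 kx.1 else p.2 kx.1
  left_inv v := by
    funext i
    obtain ⟨k, x, rfl⟩ := exists_childIdx i
    dsimp only [childIdx]
    rw [Equiv.symm_apply_apply]
    fin_cases x
    · simp [sumHalf, oddHalf, childIdx, add_assoc, zmod_two_add_self]
    · simp [oddHalf, childIdx]
  right_inv p := by
    refine Prod.ext (funext fun k => ?_) (funext fun k => ?_)
    · simp [sumHalf, childIdx, add_assoc, zmod_two_add_self]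
    · simp [oddHalf, childIdx]

theorem sum_halves {M : Type*} [AddCommMonoid M] {n : ℕ}
    (F : (Fin (2 ^ n) → ZMod 2) → (Fin (2 ^ n) → ZMod 2) → M) :
    ∑ v : Fin (2 ^ (n + 1)) → ZMod 2, F (sumHalf v) (oddHalf v) = ∑ p, ∑ q, F p q := by
  rw [← Fintype.sum_prod_type']
  exact Fintype.sum_equiv (halvesEquiv n) _ _ fun _ => rfl

theorem agree_below_childIdx_iff {n : ℕ} (k : Fin (2 ^ n)) (u v : Fin (2 ^ (n + 1)) → ZMod 2) :
    (∀ j < childIdx k 0, v j = u j) ↔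
      (∀ j < k, sumHalf v j = sumHalf u j) ∧ ∀ j < k, oddHalf v j = oddHalf u j := by
  constructor
  · intro h
    have hj : ∀ j < k, ∀ x, v (childIdx j x) = u (childIdx j x) := fun j hj x => by
      refine h _ ?_
      rw [Fin.lt_def, childIdx_val, childIdx_val]
      have := Fin.lt_def.1 hj
      have := x.2
      simp only [Fin.val_zero]
      omega
    exact ⟨fun j h => by simp only [sumHalf, hj j h], fun j h => hj j h 1⟩
  · rintro ⟨h0, h1⟩ j hj
    obtain ⟨j, x, rfl⟩ := exists_childIdx j
    have hjk : j < k := by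
      rw [Fin.lt_def, childIdx_val, childIdx_val] at hj
      rw [Fin.lt_def]
      simp only [Fin.val_zero] at hj
      omega
    have h0 := h0 j hjk
    have h1 := h1 j hjk
    simp only [sumHalf, oddHalf] at h0 h1
    rw [h1] at h0
    fin_cases x
    · exact add_right_cancel h0
    · exact h1

theorem agree_below_childIdx_one_iff {n : ℕ} (k : Fin (2 ^ n))
    (u v : Fin (2 ^ (n + 1)) → ZMod 2) :
    (∀ j < childIdx k 1, v j = u j) ↔
      (∀ j < childIdx k 0, v j = u j) ∧ v (childIdx k 0) = u (childIdx k 0) := by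
  have h : ∀ j, j < childIdx k 1 ↔ j < childIdx k 0 ∨ j = childIdx k 0 := by
    intro j
    rw [Fin.lt_def, Fin.lt_def, Fin.ext_iff, childIdx_val, childIdx_val]
    simp only [Fin.val_zero, Fin.val_one]
    omega
  simp only [h, or_imp, forall_and, forall_eq]

namespace BMS

/-- The density of the outputs `y` of independent uses of `W` when the word `u` is encoded. -/
noncomputable def wordDens (W : BMS.{u}) {n : ℕ} (u : Fin (2 ^ n) → ZMod 2)
    (y : Fin (2 ^ n) → W.Out) : ℝ :=
  ∏ j, W.dens ((u ᵥ* polarMatrix n) j) (y j)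

theorem wordDens_nonneg (W : BMS.{u}) {n : ℕ} (u : Fin (2 ^ n) → ZMod 2)
    (y : Fin (2 ^ n) → W.Out) : 0 ≤ W.wordDens u y :=
  Finset.prod_nonneg fun _ _ => W.dens_nonneg _ _

theorem measurable_wordDens (W : BMS.{u}) {n : ℕ} (u : Fin (2 ^ n) → ZMod 2) :
    Measurable (W.wordDens u) :=
  Finset.measurable_prod _ fun j _ => (W.measurable_dens _).comp (measurable_pi_apply j)

theorem wordDens_succ (W : BMS.{u}) {n : ℕ} (v : Fin (2 ^ (n + 1)) → ZMod 2)
    (y : Fin (2 ^ (n + 1)) → W.Out) :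
    W.wordDens v y = W.wordDens (sumHalf v) (fun k => y (childIdx k 0)) *
      W.wordDens (oddHalf v) (fun k => y (childIdx k 1)) := by
  simp only [wordDens, prod_childIdx, vecMul_polarMatrix_zero, vecMul_polarMatrix_one]

theorem bitDens_eq (W : BMS.{u}) {n : ℕ} (i : Fin (2 ^ n)) (y : Fin (2 ^ n) → W.Out)
    (u : Fin (2 ^ n) → ZMod 2) (b : ZMod 2) :
    W.bitDens i y u b = 1 / 2 ^ (2 ^ n - 1) *
      ∑ v, if (∀ j < i, v j = u j) ∧ v i = b then W.wordDens v y else 0 := by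
  rw [bitDens, Finset.sum_filter]
  rfl

theorem two_pow_succ_sub_one (n : ℕ) :
    (1 : ℝ) / 2 ^ (2 ^ (n + 1) - 1) = 1 / 2 * (1 / 2 ^ (2 ^ n - 1)) * (1 / 2 ^ (2 ^ n - 1)) := by
  have h : 2 ^ (n + 1) - 1 = 1 + (2 ^ n - 1) + (2 ^ n - 1) := by
    have := Nat.one_le_two_pow (n := n)
    omega
  rw [h, pow_add, pow_add]
  field_simp

theorem bitDens_childIdx_zero (W : BMS.{u}) {n : ℕ} (k : Fin (2 ^ n))
    (y : Fin (2 ^ (n + 1)) → W.Out) (u : Fin (2 ^ (n + 1)) → ZMod 2) (b : ZMod 2) :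
    W.bitDens (childIdx k 0) y u b = 1 / 2 * ∑ a : ZMod 2,
      W.bitDens k (fun l => y (childIdx l 0)) (sumHalf u) (b + a) *
        W.bitDens k (fun l => y (childIdx l 1)) (oddHalf u) a := by
  simp only [bitDens_eq, two_pow_succ_sub_one, wordDens_succ]
  have hv : ∀ v : Fin (2 ^ (n + 1)) → ZMod 2,
      ((∀ j < childIdx k 0, v j = u j) ∧ v (childIdx k 0) = b) ↔
        ((∀ j < k, sumHalf v j = sumHalf u j) ∧ ∀ j < k, oddHalf v j = oddHalf u j) ∧
          sumHalf v k = b + oddHalf v k := by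
    intro v
    rw [agree_below_childIdx_iff, ← zmod_two_add_eq_iff]
    simp [sumHalf, oddHalf, add_assoc, zmod_two_add_self]
  rw [Finset.sum_congr rfl fun v _ => if_congr (hv v) rfl rfl, sum_halves fun p q =>
    if ((∀ j < k, p j = sumHalf u j) ∧ ∀ j < k, q j = oddHalf u j) ∧ p k = b + q k then
      W.wordDens p (fun l => y (childIdx l 0)) * W.wordDens q (fun l => y (childIdx l 1))
    else 0]
  have hR : ∀ a : ZMod 2, 1 / 2 ^ (2 ^ n - 1) *
      (∑ p : Fin (2 ^ n) → ZMod 2, if (∀ j < k, p j = sumHalf u j) ∧ p k = b + a then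
        W.wordDens p (fun l => y (childIdx l 0)) else 0) *
      (1 / 2 ^ (2 ^ n - 1) *
      ∑ q : Fin (2 ^ n) → ZMod 2, if (∀ j < k, q j = oddHalf u j) ∧ q k = a then
        W.wordDens q (fun l => y (childIdx l 1)) else 0) =
      1 / 2 ^ (2 ^ n - 1) * (1 / 2 ^ (2 ^ n - 1)) * ∑ p : Fin (2 ^ n) → ZMod 2,
        ∑ q : Fin (2 ^ n) → ZMod 2, if a = q k then
          (if ((∀ j < k, p j = sumHalf u j) ∧ ∀ j < k, q j = oddHalf u j) ∧ p k = b + q k then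
            W.wordDens p (fun l => y (childIdx l 0)) * W.wordDens q (fun l => y (childIdx l 1))
          else 0) else 0 := by
    intro a
    rw [mul_mul_mul_comm, Finset.sum_mul_sum]
    congr 1
    refine Finset.sum_congr rfl fun p _ => Finset.sum_congr rfl fun q _ => ?_
    rw [ite_zero_mul_ite_zero]
    by_cases ha : a = q k
    · subst ha
      rw [if_pos rfl]
      refine if_congr ?_ rfl rfl
      tauto
    · rw [if_neg ha, if_neg]
      tauto
  simp only [hR]
  rw [← Finset.mul_sum]
  simp only [Finset.sum_comm (s := (Finset.univ : Finset (ZMod 2))), Finset.sum_ite_eq',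
    Finset.mem_univ, if_true]
  ring

theorem bitDens_childIdx_one (W : BMS.{u}) {n : ℕ} (k : Fin (2 ^ n))
    (y : Fin (2 ^ (n + 1)) → W.Out) (u : Fin (2 ^ (n + 1)) → ZMod 2) (b : ZMod 2) :
    W.bitDens (childIdx k 1) y u b = 1 / 2 *
      (W.bitDens k (fun l => y (childIdx l 0)) (sumHalf u) (b + u (childIdx k 0)) *
        W.bitDens k (fun l => y (childIdx l 1)) (oddHalf u) b) := by
  simp only [bitDens_eq, two_pow_succ_sub_one, wordDens_succ]
  have hv : ∀ v : Fin (2 ^ (n + 1)) → ZMod 2,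
      ((∀ j < childIdx k 1, v j = u j) ∧ v (childIdx k 1) = b) ↔
        ((∀ j < k, sumHalf v j = sumHalf u j) ∧ sumHalf v k = b + u (childIdx k 0)) ∧
          (∀ j < k, oddHalf v j = oddHalf u j) ∧ oddHalf v k = b := by
    intro v
    rw [agree_below_childIdx_one_iff, agree_below_childIdx_iff]
    have : oddHalf v k = b → (v (childIdx k 0) = u (childIdx k 0) ↔
        sumHalf v k = b + u (childIdx k 0)) := by
      rintro rfl
      rw [add_comm (oddHalf v k)]
      exact (add_left_inj _).symm
    change (_ ∧ _) ∧ oddHalf v k = b ↔ _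
    tauto
  rw [Finset.sum_congr rfl fun v _ => if_congr (hv v) rfl rfl, sum_halves fun p q =>
    if ((∀ j < k, p j = sumHalf u j) ∧ p k = b + u (childIdx k 0)) ∧
        (∀ j < k, q j = oddHalf u j) ∧ q k = b then
      W.wordDens p (fun l => y (childIdx l 0)) * W.wordDens q (fun l => y (childIdx l 1))
    else 0, mul_mul_mul_comm (1 / 2 ^ (2 ^ n - 1) : ℝ), Finset.sum_mul_sum, ← mul_assoc,
    ← mul_assoc]
  simp only [ite_zero_mul_ite_zero]

theorem tree_snoc_zero (W : BMS.{u}) {n : ℕ} (σ : Fin n → Fin 2) :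
    W.tree (Fin.snoc σ 0 : Fin (n + 1) → Fin 2) = (W.tree σ).check := by
  simp [tree]

theorem tree_snoc_one (W : BMS.{u}) {n : ℕ} (σ : Fin n → Fin 2) :
    W.tree (Fin.snoc σ 1 : Fin (n + 1) → Fin 2) = (W.tree σ).variableNode := by
  simp [tree]

/-! ### The channels of the individual bits are tree channels -/

theorem measurePreserving_halves {n : ℕ} {α : Type*} [MeasurableSpace α] (μ : Measure α)
    [SigmaFinite μ] :
    MeasurePreserving (fun y : Fin (2 ^ (n + 1)) → α =>
        ((fun k : Fin (2 ^ n) => y (childIdx k 0)), fun k : Fin (2 ^ n) => y (childIdx k 1)))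
      (Measure.pi fun _ => μ) ((Measure.pi fun _ => μ).prod (Measure.pi fun _ => μ)) := by
  let e : Fin (2 ^ n) ⊕ Fin (2 ^ n) ≃ Fin (2 ^ (n + 1)) :=
    ((Equiv.boolProdEquivSum _).symm.trans (Equiv.prodComm _ _)).trans
      (((Equiv.refl _).prodCongr finTwoEquiv.symm).trans finProdFinEquiv)
  have h1 := (measurePreserving_piCongrLeft (fun _ : Fin (2 ^ (n + 1)) => μ) e).symm
  have h2 := measurePreserving_sumPiEquivProdPi (fun _ : Fin (2 ^ n) ⊕ Fin (2 ^ n) => μ)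
  exact h2.comp h1

/-- The channel with densities `b ↦ 2 ^ i * W.bitDens i y u b`, that is the channel of the bit `i`
given the previous bits `u`, is the channel `V` up to a measure-preserving map of the outputs. -/
def BitChannelIs (W V : BMS.{u}) {n : ℕ} (i : Fin (2 ^ n)) (u : Fin (2 ^ n) → ZMod 2) : Prop :=
  ∃ T : (Fin (2 ^ n) → W.Out) → V.Out, MeasurePreserving T (Measure.pi fun _ => W.ref) V.ref ∧
    ∀ b y, 2 ^ (i : ℕ) * W.bitDens i y u b = V.dens b (T y)

theorem bitChannelIs_tree (W : BMS.{u}) {n : ℕ} (i : Fin (2 ^ n)) (u : Fin (2 ^ n) → ZMod 2) :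
    W.BitChannelIs (W.tree (bits n i)) i u := by
  induction n with
  | zero =>
    have : Unique (Fin (2 ^ 0)) := inferInstanceAs (Unique (Fin 1))
    have hW : W.tree (bits 0 i) = W := by rw [tree]
    rw [hW]
    refine ⟨fun y => y default, ?_, fun b y => ?_⟩
    · convert measurePreserving_funUnique W.ref (Fin (2 ^ 0)) with y
      exact congrArg y (Subsingleton.elim _ this.default)
    obtain rfl : i = default := Subsingleton.elim _ _
    have hv : ∀ v : Fin (2 ^ 0) → ZMod 2,
        ((∀ j < default, v j = u j) ∧ v default = b) ↔ v = fun _ => b := by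
      intro v
      refine ⟨fun h => funext fun j => by rw [Subsingleton.elim j default, h.2], ?_⟩
      rintro rfl
      exact ⟨fun j hj => absurd hj (by rw [Subsingleton.elim j default]; exact lt_irrefl _), rfl⟩
    have h0 : ((default : Fin (2 ^ 0)) : ℕ) = 0 := by
      have := (default : Fin (2 ^ 0)).2
      omega
    rw [bitDens_eq, Finset.sum_congr rfl fun v _ => if_congr (hv v) rfl rfl]
    simp [wordDens, polarMatrix]
    exact congrArg _ (congrArg y (Subsingleton.elim _ _))
  | succ n ih =>
    obtain ⟨k, x, rfl⟩ := exists_childIdx i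
    obtain ⟨T, hT, hT'⟩ := ih k (sumHalf u)
    obtain ⟨S, hS, hS'⟩ := ih k (oddHalf u)
    rw [bits_childIdx]
    obtain rfl | rfl : x = 0 ∨ x = 1 := by revert x; decide
    · rw [tree_snoc_zero]
      refine ⟨fun y => (T fun l => y (childIdx l 0), S fun l => y (childIdx l 1)),
        (hT.prod hS).comp (measurePreserving_halves W.ref), fun b y => ?_⟩
      rw [bitDens_childIdx_zero, childIdx_val]
      change _ = 1 / 2 * ∑ a : ZMod 2, (W.tree (bits n k)).dens (b + a) _ *
        (W.tree (bits n k)).dens a _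
      rw [← mul_assoc, mul_comm _ (1 / 2 : ℝ), mul_assoc, Finset.mul_sum]
      congr 1
      refine Finset.sum_congr rfl fun a _ => ?_
      rw [← hT', ← hS', Fin.val_zero, zero_add, two_mul, pow_add]
      ring
    · rw [tree_snoc_one]
      obtain ⟨f, hf, hf'⟩ := (W.tree (bits n k)).exists_flip
      refine ⟨fun y => (f (u (childIdx k 0)) (T fun l => y (childIdx l 0)),
        S fun l => y (childIdx l 1)),
        (((hf _).comp hT).prod hS).comp (measurePreserving_halves W.ref), fun b y => ?_⟩
      rw [bitDens_childIdx_one, childIdx_val]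
      change _ = (W.tree (bits n k)).dens b _ * (W.tree (bits n k)).dens b _
      rw [← hf', ← hT', ← hS', Fin.val_one, two_mul, pow_add, pow_add]
      ring

/-! ### Output laws -/

instance isProbabilityMeasure_law (W : BMS.{u}) (x : ZMod 2) : IsProbabilityMeasure (W.law x) := by
  refine ⟨?_⟩
  rw [law, withDensity_apply _ MeasurableSet.univ, Measure.restrict_univ,
    ← ofReal_integral_eq_lintegral_ofReal (W.integrable_dens x)
      (Eventually.of_forall (W.dens_nonneg x)), W.integral_dens, ENNReal.ofReal_one]

theorem law_real_apply (W : BMS.{u}) (x : ZMod 2) {A : Set W.Out} (hA : MeasurableSet A) :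
    (W.law x).real A = ∫ y in A, W.dens x y ∂W.ref := by
  rw [measureReal_def, law, withDensity_apply _ hA,
    ← ofReal_integral_eq_lintegral_ofReal (W.integrable_dens x).integrableOn
      (Eventually.of_forall (W.dens_nonneg x)), ENNReal.toReal_ofReal]
  exact integral_nonneg (W.dens_nonneg x)

theorem measurePreserving_law (W : BMS.{u}) {f : W.Out → W.Out} {x x' : ZMod 2}
    (hf : MeasurePreserving f W.ref W.ref) (hx : ∀ y, W.dens x' y = W.dens x (f y)) :
    MeasurePreserving f (W.law x') (W.law x) := by
  refine ⟨hf.measurable, Measure.ext fun s hs => ?_⟩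
  rw [Measure.map_apply hf.measurable hs, law, law, withDensity_apply _ hs,
    withDensity_apply _ (hf.measurable hs)]
  simp_rw [hx]
  exact hf.setLIntegral_comp_preimage hs (W.measurable_dens x).ennreal_ofReal

/-- The law of the channel outputs when the word `u` is encoded. -/
noncomputable def wordLaw (W : BMS.{u}) {n : ℕ} (u : Fin (2 ^ n) → ZMod 2) :
    Measure (Fin (2 ^ n) → W.Out) :=
  Measure.pi fun j => W.law ((u ᵥ* polarMatrix n) j)

instance isProbabilityMeasure_wordLaw (W : BMS.{u}) {n : ℕ} (u : Fin (2 ^ n) → ZMod 2) :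
    IsProbabilityMeasure (W.wordLaw u) := by
  unfold wordLaw
  infer_instance

theorem wordLaw_eq_withDensity (W : BMS.{u}) {n : ℕ} (u : Fin (2 ^ n) → ZMod 2) :
    W.wordLaw u = (Measure.pi fun _ => W.ref).withDensity fun y =>
      ENNReal.ofReal (W.wordDens u y) := by
  refine Measure.pi_eq fun s hs => ?_
  have hi : ∀ j, Integrable (W.dens ((u ᵥ* polarMatrix n) j)) (W.ref.restrict (s j)) :=
    fun j => (W.integrable_dens _).integrableOn
  rw [withDensity_apply _ (MeasurableSet.univ_pi hs), Measure.restrict_pi_pi]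
  unfold wordDens
  rw [← ofReal_integral_eq_lintegral_ofReal (Integrable.fintype_prod_dep hi)
      (Eventually.of_forall (W.wordDens_nonneg u)), integral_fintype_prod_eq_prod,
    ENNReal.ofReal_prod_of_nonneg fun j _ => integral_nonneg (W.dens_nonneg _)]
  refine Finset.prod_congr rfl fun j _ => ?_
  rw [← W.law_real_apply _ (hs j), ofReal_measureReal]

/-! ### Symmetry of the code under translation by codewords -/

/-- Two words which agree up to bit `i` are exchanged by a symmetry of the outputs that does not
affect the decision on bit `i` made with knowledge of the previous bits. -/
theorem exists_translation (W : BMS.{u}) {n : ℕ} (i : Fin (2 ^ n)) (u v : Fin (2 ^ n) → ZMod 2)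
    (huv : ∀ j ≤ i, v j = u j) : ∃ τ : (Fin (2 ^ n) → W.Out) → Fin (2 ^ n) → W.Out,
      MeasurePreserving τ (W.wordLaw v) (W.wordLaw u) ∧
      ∀ y b, W.bitDens i (τ y) u b = W.bitDens i y u b := by
  obtain ⟨f, hf, hf'⟩ := W.exists_flip
  set w := v - u with hw
  have hvw : v = u + w := by rw [hw]; abel
  have hw0 : ∀ j ≤ i, w j = 0 := fun j hj => by rw [hw, Pi.sub_apply, huv j hj, sub_self]
  refine ⟨fun y j => f ((w ᵥ* polarMatrix n) j) (y j), ?_, fun y b => ?_⟩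
  · refine measurePreserving_pi _ _ fun j => W.measurePreserving_law (hf _) fun y => ?_
    rw [hvw, Matrix.add_vecMul, Pi.add_apply, hf']
  · rw [bitDens_eq, bitDens_eq]
    congr 1
    refine Fintype.sum_equiv (Equiv.addRight w) _ _ fun v' => ?_
    have h1 : ((∀ j < i, v' j = u j) ∧ v' i = b) ↔
        (∀ j < i, (Equiv.addRight w v') j = u j) ∧ (Equiv.addRight w v') i = b := by
      simp only [Equiv.coe_addRight, Pi.add_apply, hw0 i le_rfl, add_zero]
      refine and_congr_left fun _ => forall₂_congr fun j hj => ?_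
      rw [hw0 j hj.le, add_zero]
    refine if_congr h1 ?_ rfl
    simp only [wordDens, ← hf', Equiv.coe_addRight, Matrix.add_vecMul, Pi.add_apply]

theorem measurable_bitDens (W : BMS.{u}) {n : ℕ} (i : Fin (2 ^ n)) (u : Fin (2 ^ n) → ZMod 2)
    (b : ZMod 2) : Measurable fun y => W.bitDens i y u b :=
  Measurable.const_mul (Finset.measurable_sum _ fun v _ => W.measurable_wordDens v) _

theorem bitDens_congr (W : BMS.{u}) {n : ℕ} (i : Fin (2 ^ n)) (y : Fin (2 ^ n) → W.Out)
    {u u' : Fin (2 ^ n) → ZMod 2} (h : ∀ j < i, u j = u' j) (b : ZMod 2) :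
    W.bitDens i y u b = W.bitDens i y u' b := by
  rw [bitDens_eq, bitDens_eq]
  congr 1
  refine Finset.sum_congr rfl fun v _ => if_congr (and_congr_left fun _ => ?_) rfl rfl
  exact forall₂_congr fun j hj => by rw [h j hj]

/-- Given the true values `u` of the previous bits, the pair of likelihoods of bit `i` is
distributed, up to scaling, as the pair of densities of the bit channel `V` with input `u i`. By
translation symmetry all words that extend `u 0, …, u i` have equal probability of any event about
these likelihoods, so that this probability equals the average over all such words. -/
theorem wordLaw_bitDens (W V : BMS.{u}) {n : ℕ} {i : Fin (2 ^ n)} {u : Fin (2 ^ n) → ZMod 2}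
    (hV : W.BitChannelIs V i u) {S : Set (ℝ × ℝ)} (hS : MeasurableSet S) :
    W.wordLaw u {y | (2 ^ (i : ℕ) * W.bitDens i y u 0, 2 ^ (i : ℕ) * W.bitDens i y u 1) ∈ S} =
      V.law (u i) {z | (V.dens 0 z, V.dens 1 z) ∈ S} := by
  obtain ⟨T, hT, hT'⟩ := hV
  set Ext : Finset (Fin (2 ^ n) → ZMod 2) := {v | (∀ j < i, v j = u j) ∧ v i = u i} with hExt
  set K : ℝ := 2 ^ (2 ^ n - 1) / 2 ^ (i : ℕ) with hK
  have hK0 : 0 < K := by positivity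
  have key : ∀ S : Set (ℝ × ℝ), MeasurableSet S → (Ext.card : ENNReal) * W.wordLaw u
      {y | (2 ^ (i : ℕ) * W.bitDens i y u 0, 2 ^ (i : ℕ) * W.bitDens i y u 1) ∈ S} =
      ENNReal.ofReal K * V.law (u i) {z | (V.dens 0 z, V.dens 1 z) ∈ S} := by
    intro S hS
    set E := {y | (2 ^ (i : ℕ) * W.bitDens i y u 0, 2 ^ (i : ℕ) * W.bitDens i y u 1) ∈ S} with hE
    have hEm : MeasurableSet E := (((W.measurable_bitDens i u 0).const_mul _).prodMk
      ((W.measurable_bitDens i u 1).const_mul _)) hS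
    have hS' : MeasurableSet {z | (V.dens 0 z, V.dens 1 z) ∈ S} :=
      ((V.measurable_dens 0).prodMk (V.measurable_dens 1)) hS
    have hET : E = T ⁻¹' {z | (V.dens 0 z, V.dens 1 z) ∈ S} := by
      ext y
      simp only [hE, Set.mem_ofPred_eq, Set.mem_preimage, hT']
    have h1 : ∀ v ∈ Ext, W.wordLaw v E = W.wordLaw u E := by
      intro v hv
      rw [hExt, Finset.mem_filter] at hv
      obtain ⟨τ, hτ, hτ'⟩ := W.exists_translation i u v fun j hj => by
        rcases hj.eq_or_lt with rfl | hj
        exacts [hv.2.2, hv.2.1 j hj]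
      rw [← hτ.measure_preimage hEm.nullMeasurableSet]
      congr 1
      ext y
      simp only [hE, Set.mem_ofPred_eq, Set.mem_preimage, hτ']
    rw [← nsmul_eq_mul, ← Finset.sum_const, ← Finset.sum_congr rfl h1]
    have hm : ∀ v ∈ Ext, Measurable fun y => ENNReal.ofReal (W.wordDens v y) :=
      fun v _ => (W.measurable_wordDens v).ennreal_ofReal
    have h2 : ∀ y, ∑ v ∈ Ext, ENNReal.ofReal (W.wordDens v y) =
        ENNReal.ofReal K * ENNReal.ofReal (V.dens (u i) (T y)) := by
      intro y
      rw [← ENNReal.ofReal_sum_of_nonneg fun v _ => W.wordDens_nonneg v y,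
        ← ENNReal.ofReal_mul hK0.le, ← hT', bitDens, hK]
      congr 1
      change ∑ v ∈ Ext, W.wordDens v y = _ * (_ * (_ * ∑ v ∈ Ext, W.wordDens v y))
      field_simp
    simp_rw [wordLaw_eq_withDensity, withDensity_apply _ hEm]
    rw [← lintegral_finsetSum' _ fun v hv => (hm v hv).aemeasurable]
    simp_rw [h2]
    rw [lintegral_const_mul' _ _ ENNReal.ofReal_ne_top, law,
      withDensity_apply _ hS', hET,
      hT.setLIntegral_comp_preimage hS' (V.measurable_dens (u i)).ennreal_ofReal]
  have h1 := key Set.univ MeasurableSet.univ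
  simp only [Set.mem_univ, Set.ofPred_true, measure_univ, mul_one] at h1
  have h2 := key S hS
  rw [h1] at h2
  exact (ENNReal.mul_right_inj (by simpa using hK0) ENNReal.ofReal_ne_top).1 h2

theorem wordLaw_real_bitDens (W V : BMS.{u}) {n : ℕ} {i : Fin (2 ^ n)}
    {u : Fin (2 ^ n) → ZMod 2} (hV : W.BitChannelIs V i u) {S : Set (ℝ × ℝ)}
    (hS : MeasurableSet S) (hc : ∀ c > 0, ∀ s t : ℝ, (c * s, c * t) ∈ S ↔ (s, t) ∈ S) :
    (W.wordLaw u).real {y | (W.bitDens i y u 0, W.bitDens i y u 1) ∈ S} =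
      (V.law (u i)).real {z | (V.dens 0 z, V.dens 1 z) ∈ S} := by
  rw [measureReal_def, measureReal_def, ← wordLaw_bitDens W V hV hS]
  simp only [hc _ (pow_pos (two_pos : (0 : ℝ) < 2) (i : ℕ))]

/-! ### Error probability of a single bit -/

theorem measurableSet_dens_le (W : BMS.{u}) (x x' : ZMod 2) :
    MeasurableSet {y | W.dens x y ≤ W.dens x' y} :=
  measurableSet_le (W.measurable_dens x) (W.measurable_dens x')

theorem law_real_dens_le_le_bhattacharyya (W : BMS.{u}) (x : ZMod 2) :
    (W.law x).real {y | W.dens x y ≤ W.dens (x + 1) y} ≤ W.bhattacharyya := by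
  have hA := W.measurableSet_dens_le x (x + 1)
  rw [W.law_real_apply x hA]
  refine le_trans ?_ (setIntegral_le_integral (s := {y | W.dens x y ≤ W.dens (x + 1) y})
    W.integrable_sqrt_dens (Eventually.of_forall fun _ => Real.sqrt_nonneg _))
  refine setIntegral_mono_on (W.integrable_dens x).integrableOn
    W.integrable_sqrt_dens.integrableOn hA fun y hy => ?_
  have h0 := W.dens_nonneg x y
  have e : W.dens 0 y * W.dens 1 y = W.dens x y * W.dens (x + 1) y := by
    have h11 : (1 : ZMod 2) + 1 = 0 := by decide
    obtain rfl | rfl := zmod_two_cases x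
    · rw [zero_add]
    · rw [h11, mul_comm]
  rw [e]
  exact Real.le_sqrt_of_sq_le (by rw [sq]; exact mul_le_mul_of_nonneg_left hy h0)

/-- The Bhattacharyya parameter is small when the error probability of the maximum likelihood
decision is: `√(ab) ≤ (l min(a, b) + (a + b) / l) / 2` for all `l > 0`. -/
theorem bhattacharyya_le_of_error (W : BMS.{u}) {l : ℝ} (hl : 0 < l) :
    W.bhattacharyya ≤ l * (((W.law 0).real {y | W.dens 0 y < W.dens 1 y} +
      (W.law 1).real {y | W.dens 1 y ≤ W.dens 0 y}) / 2) + 1 / l := by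
  have hB := W.measurableSet_dens_le 1 0
  have hA : MeasurableSet {y | W.dens 0 y < W.dens 1 y} :=
    measurableSet_lt (W.measurable_dens 0) (W.measurable_dens 1)
  rw [W.law_real_apply 0 hA, W.law_real_apply 1 hB, ← integral_indicator hA,
    ← integral_indicator hB]
  have i0 := (W.integrable_dens 0).indicator hA
  have i1 := (W.integrable_dens 1).indicator hB
  have i2 := (i0.add i1).const_mul (l / 2)
  have i3 := W.integrable_mean.div_const l
  have h := integral_mono W.integrable_sqrt_dens (i2.add i3) fun y => by
    have ha := W.dens_nonneg 0 y
    have hb := W.dens_nonneg 1 y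
    have amgm : ∀ s t : ℝ, 0 ≤ s → 0 ≤ t →
        Real.sqrt (s * t) ≤ l / 2 * s + t / 2 / l := fun s t hs ht => by
      have := sqrt_mul_le_half_add (mul_nonneg hl.le hs) (div_nonneg ht hl.le)
      have e : l * s * (t / l) = s * t := by field_simp
      rw [e] at this
      refine this.trans_eq ?_
      ring
    simp only [Pi.add_apply, Set.indicator, Set.mem_ofPred_eq, mean]
    rcases lt_or_ge (W.dens 0 y) (W.dens 1 y) with hlt | hge
    · rw [if_pos hlt, if_neg (not_le.2 hlt), add_zero]
      refine (amgm _ _ ha hb).trans ?_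
      gcongr
      linarith
    · rw [if_neg (not_lt.2 hge), if_pos hge, zero_add, mul_comm (W.dens 0 y)]
      refine (amgm _ _ hb ha).trans ?_
      gcongr
      linarith
  rw [integral_add' i2 i3, integral_const_mul, integral_add' i0 i1, integral_div,
    W.integral_mean] at h
  refine h.trans_eq ?_
  ring

/-! ### Block error probability of the successive cancellation decoder -/

theorem scDecode_of_agree (W : BMS.{u}) {n : ℕ} (A : Finset (Fin (2 ^ n)))
    (y : Fin (2 ^ n) → W.Out) (u : Fin (2 ^ n) → ZMod 2) (i : Fin (2 ^ n))
    (h : ∀ j < i, W.scDecode A y j = u j) : W.scDecode A y i =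
      if i ∈ A then if W.bitDens i y u 1 ≤ W.bitDens i y u 0 then 0 else 1 else 0 := by
  rw [scDecode]
  have hp : ∀ b, W.bitDens i y (fun j => if _h : j < i then W.scDecode A y j else 0) b =
      W.bitDens i y u b := fun b => W.bitDens_congr i y (fun j hj => by rw [dif_pos hj, h j hj]) b
  simp only [hp]

theorem exists_mem_le_of_scDecode_ne (W : BMS.{u}) {n : ℕ} {A : Finset (Fin (2 ^ n))}
    {y : Fin (2 ^ n) → W.Out} {u : Fin (2 ^ n) → ZMod 2} (hu : ∀ i, i ∉ A → u i = 0)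
    (h : W.scDecode A y ≠ u) : ∃ i ∈ A, W.bitDens i y u (u i) ≤ W.bitDens i y u (u i + 1) := by
  by_contra! hlt
  refine h (funext fun i => ?_)
  induction i using WellFoundedLT.induction with
  | _ i ih =>
    rw [W.scDecode_of_agree A y u i ih]
    by_cases hi : i ∈ A
    · have := hlt i hi
      have h11 : (1 : ZMod 2) + 1 = 0 := by decide
      rw [if_pos hi]
      obtain hx | hx := zmod_two_cases (u i)
      · rw [hx, zero_add] at this
        rw [hx, if_pos this.le]
      · rw [hx, h11] at this
        rw [hx, if_neg (not_le.2 this)]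
    · rw [if_neg hi, hu i hi]

/-- The information words of the polar code with information set `A`. -/
def infoWords {n : ℕ} (A : Finset (Fin (2 ^ n))) : Finset (Fin (2 ^ n) → ZMod 2) :=
  {u | ∀ i, i ∉ A → u i = 0}

theorem mem_infoWords {n : ℕ} {A : Finset (Fin (2 ^ n))} {u : Fin (2 ^ n) → ZMod 2} :
    u ∈ infoWords A ↔ ∀ i, i ∉ A → u i = 0 := by simp [infoWords]

theorem card_infoWords {n : ℕ} (A : Finset (Fin (2 ^ n))) :
    (infoWords A).card = 2 ^ A.card := by
  have h : infoWords A =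
      Fintype.piFinset fun i => if i ∈ A then (Finset.univ : Finset (ZMod 2)) else {0} := by
    ext u
    rw [mem_infoWords, Fintype.mem_piFinset]
    refine forall_congr' fun i => ?_
    by_cases hi : i ∈ A <;> simp [hi]
  rw [h, Fintype.card_piFinset]
  have h2 : ∀ i, (if i ∈ A then (Finset.univ : Finset (ZMod 2)) else {0}).card =
      if i ∈ A then 2 else 1 := fun i => by split_ifs <;> rfl
  simp only [h2, Finset.prod_ite_mem, Finset.univ_inter, Finset.prod_const]

theorem blockError_eq (W : BMS.{u}) {n : ℕ} (A : Finset (Fin (2 ^ n))) :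
    W.blockError A = 1 / 2 ^ A.card * ∑ u ∈ infoWords A,
      (W.wordLaw u).real {y | W.scDecode A y ≠ u} := rfl

/-- Union bound over the bits of the information set, each decided with a genie that reveals the
previous bits. -/
theorem blockError_le_sum_bhattacharyya (W : BMS.{u}) {n : ℕ} (A : Finset (Fin (2 ^ n))) :
    W.blockError A ≤ ∑ i ∈ A, (W.tree (bits n i)).bhattacharyya := by
  have h : ∀ u ∈ infoWords A, (W.wordLaw u).real {y | W.scDecode A y ≠ u} ≤
      ∑ i ∈ A, (W.tree (bits n i)).bhattacharyya := by
    intro u hu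
    rw [mem_infoWords] at hu
    have hsub : {y | W.scDecode A y ≠ u} ⊆
        ⋃ i ∈ A, {y | W.bitDens i y u (u i) ≤ W.bitDens i y u (u i + 1)} := fun y hy => by
      obtain ⟨i, hi, hle⟩ := W.exists_mem_le_of_scDecode_ne hu hy
      exact Set.mem_biUnion hi hle
    refine (measureReal_mono hsub (measure_ne_top _ _)).trans
      ((measureReal_biUnion_finset_le A _).trans ?_)
    refine Finset.sum_le_sum fun i _ => ?_
    refine le_trans (le_of_eq ?_) ((W.tree (bits n i)).law_real_dens_le_le_bhattacharyya (u i))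
    have h11 : (1 : ZMod 2) + 1 = 0 := by decide
    obtain hx | hx := zmod_two_cases (u i)
    · rw [hx, zero_add]
      have := W.wordLaw_real_bitDens _ (W.bitChannelIs_tree i u)
        (S := {p : ℝ × ℝ | p.1 ≤ p.2}) (measurableSet_le measurable_fst measurable_snd)
        fun c hc s t => mul_le_mul_iff_right₀ hc
      rw [hx] at this
      exact this
    · rw [hx, h11]
      have := W.wordLaw_real_bitDens _ (W.bitChannelIs_tree i u)
        (S := {p : ℝ × ℝ | p.2 ≤ p.1}) (measurableSet_le measurable_snd measurable_fst)
        fun c hc s t => mul_le_mul_iff_right₀ hc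
      rw [hx] at this
      exact this
  rw [blockError_eq, ← le_div_iff₀' (by positivity)]
  refine (Finset.sum_le_card_nsmul _ _ _ h).trans_eq ?_
  rw [card_infoWords, nsmul_eq_mul]
  push_cast
  field_simp

/-- A correct block decision requires a correct decision on each bit of the information set; the two
values of such a bit are equally likely. The asymmetric resolution of ties is why the two error
events are not mirror images of each other. -/
theorem bitError_le_blockError (W : BMS.{u}) {n : ℕ} {A : Finset (Fin (2 ^ n))} {i : Fin (2 ^ n)}
    (hi : i ∈ A) {V : BMS.{u}} (hV : V = W.tree (bits n i)) :
    ((V.law 0).real {z | V.dens 0 z < V.dens 1 z} +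
      (V.law 1).real {z | V.dens 1 z ≤ V.dens 0 z}) / 2 ≤ W.blockError A := by
  set g : ZMod 2 → ℝ := fun c => if c = 0 then (V.law 0).real {z | V.dens 0 z < V.dens 1 z}
    else (V.law 1).real {z | V.dens 1 z ≤ V.dens 0 z} with hg
  have hg0 : g 0 = (V.law 0).real {z | V.dens 0 z < V.dens 1 z} := if_pos rfl
  have hg1 : g 1 = (V.law 1).real {z | V.dens 1 z ≤ V.dens 0 z} := if_neg one_ne_zero
  have h11 : (1 : ZMod 2) + 1 = 0 := by decide
  rw [← hg0, ← hg1]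
  have h : ∀ u ∈ infoWords A, g (u i) ≤ (W.wordLaw u).real {y | W.scDecode A y ≠ u} := by
    intro u _
    have hch : W.BitChannelIs V i u := hV ▸ W.bitChannelIs_tree i u
    have hdec : ∀ y, W.scDecode A y = u →
        u i = if W.bitDens i y u 1 ≤ W.bitDens i y u 0 then 0 else 1 := fun y hy => by
      have := W.scDecode_of_agree A y u i fun j _ => congrFun hy j
      rwa [if_pos hi, hy] at this
    obtain hx | hx := zmod_two_cases (u i)
    · have := W.wordLaw_real_bitDens V hch
        (S := {p : ℝ × ℝ | p.1 < p.2}) (measurableSet_lt measurable_fst measurable_snd)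
        fun c hc s t => mul_lt_mul_iff_right₀ hc
      rw [hx] at this
      rw [hx, hg0]
      refine this.symm.trans_le (measureReal_mono fun y hy hd => ?_)
      have h' := hdec y hd
      rw [if_neg (not_le.2 hy), hx] at h'
      exact zero_ne_one h'
    · have := W.wordLaw_real_bitDens V hch
        (S := {p : ℝ × ℝ | p.2 ≤ p.1}) (measurableSet_le measurable_snd measurable_fst)
        fun c hc s t => mul_le_mul_iff_right₀ hc
      rw [hx] at this
      rw [hx, hg1]
      refine this.symm.trans_le (measureReal_mono fun y hy hd => ?_)
      have h' := hdec y hd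
      rw [if_pos (show W.bitDens i y u 1 ≤ W.bitDens i y u 0 from hy), hx] at h'
      exact one_ne_zero h'
  have hflip : ∑ u ∈ infoWords A, g (u i) = ∑ u ∈ infoWords A, g (u i + 1) := by
    refine Finset.sum_equiv (Equiv.addRight (Pi.single i 1)) (fun u => ?_) fun u _ => ?_
    · rw [mem_infoWords, mem_infoWords]
      refine forall₂_congr fun j hj => ?_
      have hji : j ≠ i := fun e => hj (e ▸ hi)
      simp [hji]
    · simp [add_assoc, h11]
  have hsum : 2 * ∑ u ∈ infoWords A, g (u i) = 2 ^ A.card * (g 0 + g 1) := by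
    have : ∀ u ∈ infoWords A, g (u i) + g (u i + 1) = g 0 + g 1 := fun u _ => by
      obtain hx | hx := zmod_two_cases (u i)
      · rw [hx, zero_add]
      · rw [hx, h11, add_comm]
    rw [two_mul]
    nth_rewrite 2 [hflip]
    rw [← Finset.sum_add_distrib, Finset.sum_congr rfl this, Finset.sum_const, card_infoWords,
      nsmul_eq_mul]
    push_cast
    rfl
  rw [blockError_eq, one_div, ← div_eq_inv_mul, le_div_iff₀ (by positivity)]
  refine le_trans (le_of_eq ?_) (Finset.sum_le_sum h)
  linarith

theorem bhattacharyya_le_of_blockError (W : BMS.{u}) {n : ℕ} {A : Finset (Fin (2 ^ n))}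
    {i : Fin (2 ^ n)} (hi : i ∈ A) {l : ℝ} (hl : 0 < l) :
    (W.tree (bits n i)).bhattacharyya ≤ l * W.blockError A + 1 / l := by
  refine ((W.tree (bits n i)).bhattacharyya_le_of_error hl).trans ?_
  gcongr
  exact W.bitError_le_blockError hi rfl

end BMS

/-! ### Averages over the types of a given length -/

/-- The average of `f` over all types of length `n`. -/
noncomputable def typeAvg {n : ℕ} (f : (Fin n → Fin 2) → ℝ) : ℝ := 1 / 2 ^ n * ∑ σ, f σ

theorem typeAvg_succ {n : ℕ} (f : (Fin (n + 1) → Fin 2) → ℝ) :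
    typeAvg f = typeAvg fun σ => (f (Fin.snoc σ 0) + f (Fin.snoc σ 1)) / 2 := by
  have h : ∑ τ, f τ = ∑ σ : Fin n → Fin 2, (f (Fin.snoc σ 0) + f (Fin.snoc σ 1)) := by
    rw [← (Fin.snocEquiv fun _ => Fin 2).sum_comp, Fintype.sum_prod_type_right]
    exact Finset.sum_congr rfl fun σ _ => Fin.sum_univ_two _
  rw [typeAvg, typeAvg, h, ← Finset.sum_div, pow_succ]
  field_simp

theorem typeAvg_mono {n : ℕ} {f g : (Fin n → Fin 2) → ℝ} (h : ∀ σ, f σ ≤ g σ) :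
    typeAvg f ≤ typeAvg g :=
  mul_le_mul_of_nonneg_left (Finset.sum_le_sum fun σ _ => h σ) (by positivity)

theorem typeAvg_nonneg {n : ℕ} {f : (Fin n → Fin 2) → ℝ} (h : ∀ σ, 0 ≤ f σ) : 0 ≤ typeAvg f :=
  mul_nonneg (by positivity) (Finset.sum_nonneg fun σ _ => h σ)

theorem typeAvg_add {n : ℕ} (f g : (Fin n → Fin 2) → ℝ) :
    typeAvg (fun σ => f σ + g σ) = typeAvg f + typeAvg g := by
  rw [typeAvg, Finset.sum_add_distrib, mul_add]
  rfl

theorem typeAvg_sub {n : ℕ} (f g : (Fin n → Fin 2) → ℝ) :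
    typeAvg (fun σ => f σ - g σ) = typeAvg f - typeAvg g := by
  rw [typeAvg, Finset.sum_sub_distrib, mul_sub]
  rfl

theorem typeAvg_const_mul {n : ℕ} (c : ℝ) (f : (Fin n → Fin 2) → ℝ) :
    typeAvg (fun σ => c * f σ) = c * typeAvg f := by
  rw [typeAvg, ← Finset.mul_sum, typeAvg]
  ring

theorem typeAvg_const (n : ℕ) (c : ℝ) : typeAvg (fun _ : Fin n → Fin 2 => c) = c := by
  simp [typeAvg]

theorem typeAvg_one_sub {n : ℕ} (f : (Fin n → Fin 2) → ℝ) :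
    typeAvg (fun σ => 1 - f σ) = 1 - typeAvg f := by
  rw [typeAvg_sub, typeAvg_const]

theorem sq_typeAvg_le {n : ℕ} (f : (Fin n → Fin 2) → ℝ) :
    typeAvg f ^ 2 ≤ typeAvg fun σ => f σ ^ 2 := by
  have h := sq_sum_le_card_mul_sum_sq (s := (Finset.univ : Finset (Fin n → Fin 2))) (f := f)
  have hc : ((Finset.univ : Finset (Fin n → Fin 2)).card : ℝ) = 2 ^ n := by simp
  rw [hc] at h
  rw [typeAvg, typeAvg, mul_pow]
  calc (1 / 2 ^ n : ℝ) ^ 2 * (∑ σ, f σ) ^ 2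
      ≤ (1 / 2 ^ n : ℝ) ^ 2 * (2 ^ n * ∑ σ, f σ ^ 2) := by gcongr
    _ = _ := by field_simp

/-! ### Processes dominated by the erasure channel -/

/-- A `[0, 1]`-valued function on the types whose growth along the tree is bounded by that of the
erasure probability of a binary erasure channel: `z` turns into at most `2 z - z ^ 2` at a check
node and into at most `z ^ 2` at a variable node. -/
structure ErasureDominated (M : ∀ {n : ℕ}, (Fin n → Fin 2) → ℝ) : Prop where
  nonneg : ∀ {n : ℕ} (σ : Fin n → Fin 2), 0 ≤ M σ
  le_one : ∀ {n : ℕ} (σ : Fin n → Fin 2), M σ ≤ 1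
  snoc_zero_le : ∀ {n : ℕ} (σ : Fin n → Fin 2),
    M (Fin.snoc σ 0 : Fin (n + 1) → Fin 2) ≤ 2 * M σ - M σ ^ 2
  snoc_one_le : ∀ {n : ℕ} (σ : Fin n → Fin 2), M (Fin.snoc σ 1 : Fin (n + 1) → Fin 2) ≤ M σ ^ 2

/-- The transition operator of the erasure probability under one polarization step. -/
noncomputable def erasureStep (g : ℝ → ℝ) (z : ℝ) : ℝ := (g (2 * z - z ^ 2) + g (z ^ 2)) / 2

theorem two_mul_sub_sq_mem {z : ℝ} (hz : z ∈ Set.Icc (0 : ℝ) 1) :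
    2 * z - z ^ 2 ∈ Set.Icc (0 : ℝ) 1 :=
  ⟨by nlinarith [hz.1, hz.2], by nlinarith [hz.1, hz.2]⟩

theorem sq_mem {z : ℝ} (hz : z ∈ Set.Icc (0 : ℝ) 1) : z ^ 2 ∈ Set.Icc (0 : ℝ) 1 :=
  ⟨sq_nonneg z, pow_le_one₀ hz.1 hz.2⟩

theorem MonotoneOn.erasureStep {g : ℝ → ℝ} (hg : MonotoneOn g (Set.Icc 0 1)) :
    MonotoneOn (erasureStep g) (Set.Icc 0 1) := by
  intro x hx y hy hxy
  have h1 := hg (two_mul_sub_sq_mem hx) (two_mul_sub_sq_mem hy)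
    (by nlinarith [hx.1, hx.2, hy.1, hy.2])
  have h2 := hg (sq_mem hx) (sq_mem hy) (pow_le_pow_left₀ hx.1 hxy 2)
  unfold _root_.erasureStep
  linarith

namespace ErasureDominated

variable {M : ∀ {n : ℕ}, (Fin n → Fin 2) → ℝ}

theorem mem_Icc (hM : ErasureDominated M) {n : ℕ} (σ : Fin n → Fin 2) : M σ ∈ Set.Icc (0 : ℝ) 1 :=
  ⟨hM.nonneg σ, hM.le_one σ⟩

theorem typeAvg_succ_le (hM : ErasureDominated M) {g : ℝ → ℝ} (hg : MonotoneOn g (Set.Icc 0 1))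
    (n : ℕ) : typeAvg (fun σ : Fin (n + 1) → Fin 2 => g (M σ)) ≤
      typeAvg fun σ : Fin n → Fin 2 => erasureStep g (M σ) := by
  rw [typeAvg_succ]
  refine typeAvg_mono fun σ => ?_
  have h1 := hg (hM.mem_Icc _) (two_mul_sub_sq_mem (hM.mem_Icc σ)) (hM.snoc_zero_le σ)
  have h2 := hg (hM.mem_Icc _) (sq_mem (hM.mem_Icc σ)) (hM.snoc_one_le σ)
  unfold erasureStep
  linarith

theorem typeAvg_add_le (hM : ErasureDominated M) (n k : ℕ) : ∀ {g : ℝ → ℝ},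
    MonotoneOn g (Set.Icc 0 1) → typeAvg (fun σ : Fin (n + k) → Fin 2 => g (M σ)) ≤
      typeAvg fun σ : Fin n → Fin 2 => erasureStep^[k] g (M σ) := by
  induction k with
  | zero => exact fun _ => le_rfl
  | succ k ih => exact fun hg => (hM.typeAvg_succ_le hg (n + k)).trans (ih hg.erasureStep)

theorem antitone_typeAvg (hM : ErasureDominated M) :
    Antitone fun n => typeAvg fun σ : Fin n → Fin 2 => M σ := by
  refine antitone_nat_of_succ_le fun n => ?_
  refine (hM.typeAvg_succ_le (g := fun z => z) monotoneOn_id n).trans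
    (typeAvg_mono fun σ => le_of_eq ?_)
  unfold erasureStep
  ring

/-- Polarization. The average of `g (M σ)`, for `g z = 2 z - z ^ 2`, drops in each step by at least
that of `(M σ (1 - M σ)) ^ 2`, since `g - erasureStep g` is `z ^ 2 (1 - z) ^ 2`. -/
theorem tendsto_typeAvg_mul_one_sub (hM : ErasureDominated M) :
    Tendsto (fun n => typeAvg fun σ : Fin n → Fin 2 => M σ * (1 - M σ)) atTop (𝓝 0) := by
  set g : ℝ → ℝ := fun z => 2 * z - z ^ 2 with hg
  have hgm : MonotoneOn g (Set.Icc 0 1) := fun x hx y hy hxy => by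
    simp only [hg]
    nlinarith [hx.1, hx.2, hy.1, hy.2]
  set a : ℕ → ℝ := fun n => typeAvg fun σ : Fin n → Fin 2 => g (M σ) with ha
  set q : ℕ → ℝ := fun n => typeAvg fun σ : Fin n → Fin 2 => (M σ * (1 - M σ)) ^ 2 with hq
  have hstep : ∀ n, a (n + 1) ≤ a n - q n := fun n => by
    refine (hM.typeAvg_succ_le hgm n).trans_eq ?_
    simp only [ha, hq]
    rw [← typeAvg_sub]
    congr 1
    funext σ
    simp only [erasureStep, hg]
    ring
  have hq0 : ∀ n, 0 ≤ q n := fun n => typeAvg_nonneg fun σ => sq_nonneg _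
  have ha0 : ∀ n, 0 ≤ a n := fun n => typeAvg_nonneg fun σ => by
    simp only [hg]
    nlinarith [hM.nonneg σ, hM.le_one σ]
  have hsum : ∀ n, ∑ k ∈ Finset.range n, q k ≤ a 0 - a n := fun n => by
    induction n with
    | zero => simp
    | succ n ih => rw [Finset.sum_range_succ]; linarith [hstep n]
  have hlim : Tendsto q atTop (𝓝 0) :=
    (summable_of_sum_range_le hq0 fun n =>
      (hsum n).trans (sub_le_self _ (ha0 n))).tendsto_atTop_zero
  have hlim' : Tendsto (fun n => Real.sqrt (q n)) atTop (𝓝 0) := by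
    simpa using hlim.sqrt
  refine squeeze_zero (fun n => typeAvg_nonneg fun σ => ?_) (fun n => ?_) hlim'
  · exact mul_nonneg (hM.nonneg σ) (by linarith [hM.le_one σ])
  · exact Real.le_sqrt_of_sq_le (sq_typeAvg_le _)

end ErasureDominated

/-! ### The speed of polarization -/

/-- Contraction rate of the potential `z ↦ z ^ (1 / 4)` under one polarization step, as long as the
erasure probability stays below `1 / 32`. -/
noncomputable def quarticRate : ℝ := (√√2 + √√(1 / 32)) / 2

theorem quarticRate_nonneg : 0 ≤ quarticRate := by
  unfold quarticRate
  positivity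

theorem quarticRate_mul_lt_one : quarticRate * √√2 < 1 := by
  have h1 : √√2 * √√2 = √2 := Real.mul_self_sqrt (Real.sqrt_nonneg _)
  have h2 : √√(1 / 32) * √√2 = 1 / 2 := by
    rw [← Real.sqrt_mul (Real.sqrt_nonneg _), ← Real.sqrt_mul (by norm_num)]
    have h16 : (1 / 32 * 2 : ℝ) = ((1 / 2) ^ 2) ^ 2 := by norm_num
    rw [h16, Real.sqrt_sq (by norm_num), Real.sqrt_sq (by norm_num)]
  have h3 : √2 < 3 / 2 := by
    rw [Real.sqrt_lt' (by norm_num)]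
    norm_num
  have e : quarticRate * √√2 = (√√2 * √√2 + √√(1 / 32) * √√2) / 2 := by
    unfold quarticRate
    ring
  rw [e, h1, h2]
  linarith

/-- The fraction of the `k`-step descendants of erasure probability `z` that exceed `θ`. The term
`32 z` bounds the probability that the process ever exceeds `1 / 32`; as long as it does not, the
potential `(z / θ) ^ (1 / 4)` contracts at rate `quarticRate`. -/
theorem erasureStep_iterate_indicator_le {θ : ℝ} (hθ : 0 < θ) (k : ℕ) :
    ∀ z ∈ Set.Icc (0 : ℝ) 1, erasureStep^[k] (fun z => if θ < z then 1 else 0) z ≤ 1 ∧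
      erasureStep^[k] (fun z => if θ < z then 1 else 0) z ≤
        32 * z + quarticRate ^ k * √√(z / θ) := by
  induction k with
  | zero =>
    intro z hz
    rw [Function.iterate_zero, id, pow_zero, one_mul]
    have h0 : 0 ≤ √√(z / θ) := Real.sqrt_nonneg _
    split_ifs with h
    · refine ⟨le_rfl, ?_⟩
      have h1 : 1 ≤ √√(z / θ) := Real.one_le_sqrt.2 (Real.one_le_sqrt.2 ((one_le_div hθ).2 h.le))
      linarith [hz.1]
    · exact ⟨zero_le_one, by linarith [hz.1]⟩
  | succ k ih =>
    intro z hz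
    rw [Function.iterate_succ_apply']
    obtain ⟨a1, a2⟩ := ih _ (two_mul_sub_sq_mem hz)
    obtain ⟨b1, b2⟩ := ih _ (sq_mem hz)
    rw [erasureStep]
    refine ⟨by linarith, ?_⟩
    have hr := quarticRate_nonneg
    rcases lt_or_ge (1 / 32) z with hlt | hge
    · have : 0 ≤ quarticRate ^ (k + 1) * √√(z / θ) := by positivity
      linarith
    · have h1 : √√((2 * z - z ^ 2) / θ) ≤ √√2 * √√(z / θ) := by
        rw [← Real.sqrt_mul (Real.sqrt_nonneg _), ← Real.sqrt_mul (by norm_num), ← mul_div_assoc]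
        gcongr
        linarith [sq_nonneg z]
      have h2 : √√(z ^ 2 / θ) ≤ √√(1 / 32) * √√(z / θ) := by
        rw [← Real.sqrt_mul (Real.sqrt_nonneg _), ← Real.sqrt_mul (by norm_num), ← mul_div_assoc]
        gcongr
        rw [sq]
        exact mul_le_mul_of_nonneg_right hge hz.1
      have h3 : quarticRate ^ k * (√√((2 * z - z ^ 2) / θ) + √√(z ^ 2 / θ)) ≤
          quarticRate ^ k * (2 * quarticRate * √√(z / θ)) := by
        refine mul_le_mul_of_nonneg_left ?_ (by positivity)
        have : 2 * quarticRate = √√2 + √√(1 / 32) := by unfold quarticRate; ring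
        rw [this, add_mul]
        exact add_le_add h1 h2
      rw [pow_succ quarticRate]
      linarith

theorem monotone_indicator (θ : ℝ) : Monotone fun z : ℝ => if θ < z then (1 : ℝ) else 0 := by
  intro x y hxy
  dsimp only
  split_ifs with h1 h2
  · exact le_rfl
  · exact absurd (h1.trans_le hxy) h2
  · exact zero_le_one
  · exact le_rfl

namespace ErasureDominated

variable {M : ∀ {n : ℕ}, (Fin n → Fin 2) → ℝ}

theorem typeAvg_indicator_le (hM : ErasureDominated M) (n k : ℕ) {ε : ℝ} (hε : 0 < ε) :
    typeAvg (fun σ : Fin (n + k) → Fin 2 => if ε / 2 ^ (n + k) < M σ then (1 : ℝ) else 0) ≤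
      typeAvg (fun σ : Fin n → Fin 2 => M σ) +
        32 * typeAvg (fun σ : Fin n → Fin 2 => M σ * (1 - M σ)) +
        (quarticRate * √√2) ^ k * √√(2 ^ n / ε) := by
  have hθ : 0 < ε / 2 ^ (n + k) := by positivity
  refine (hM.typeAvg_add_le n k ((monotone_indicator _).monotoneOn _)).trans ?_
  rw [← typeAvg_const_mul, ← typeAvg_add,
    ← typeAvg_const n ((quarticRate * √√2) ^ k * √√(2 ^ n / ε)), ← typeAvg_add]
  refine typeAvg_mono fun σ => ?_
  obtain ⟨h1, h2⟩ := erasureStep_iterate_indicator_le hθ k (M σ) (hM.mem_Icc σ)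
  have hm0 := hM.nonneg σ
  have hm1 := hM.le_one σ
  have hr := quarticRate_nonneg
  have hη : quarticRate ^ k * √√(M σ / (ε / 2 ^ (n + k))) ≤
      (quarticRate * √√2) ^ k * √√(2 ^ n / ε) := by
    have e : ∀ j : ℕ, √√((2 : ℝ) ^ j) = √√2 ^ j := fun j => by
      induction j with
      | zero => simp
      | succ j ih =>
        rw [pow_succ, Real.sqrt_mul (by positivity), Real.sqrt_mul (by positivity), ih, pow_succ]
    rw [mul_pow, mul_assoc, ← e, ← Real.sqrt_mul (Real.sqrt_nonneg _),
      ← Real.sqrt_mul (by positivity)]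
    refine mul_le_mul_of_nonneg_left (Real.sqrt_le_sqrt (Real.sqrt_le_sqrt ?_)) (by positivity)
    calc M σ / (ε / 2 ^ (n + k)) ≤ 1 / (ε / 2 ^ (n + k)) := by gcongr
      _ = 2 ^ k * (2 ^ n / ε) := by rw [pow_add]; field_simp
  have hη0 : 0 ≤ (quarticRate * √√2) ^ k * √√(2 ^ n / ε) := by positivity
  -- `min 1 (32 z) ≤ z + 32 z (1 - z)`
  rcases le_or_gt (M σ) (1 / 32) with h | h
  · nlinarith
  · nlinarith

/-- For suitable large `N`, a fraction arbitrarily close to `1 - typeAvg M` of all types of length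
`N` has an arbitrarily small sum of the values of `M`. -/
theorem exists_good_types (hM : ErasureDominated M) (n : ℕ) {δ ε : ℝ} (hδ : 0 < δ) (hε : 0 < ε) :
    ∃ (N : ℕ) (S : Finset (Fin N → Fin 2)),
      1 - typeAvg (fun σ : Fin n → Fin 2 => M σ) - δ ≤ (S.card : ℝ) / 2 ^ N ∧
        ∑ σ ∈ S, M σ ≤ ε := by
  obtain ⟨n', hn', hp⟩ : ∃ n' ≥ n,
      typeAvg (fun σ : Fin n' → Fin 2 => M σ * (1 - M σ)) < δ / 64 := by
    have h := (hM.tendsto_typeAvg_mul_one_sub.eventually_lt_const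
      (show (0 : ℝ) < δ / 64 by positivity)).and (eventually_ge_atTop n)
    obtain ⟨n', h1, h2⟩ := h.exists
    exact ⟨n', h2, h1⟩
  obtain ⟨k, hk⟩ : ∃ k, (quarticRate * √√2) ^ k * √√(2 ^ n' / ε) < δ / 2 := by
    have h := (tendsto_pow_atTop_nhds_zero_of_lt_one
      (mul_nonneg quarticRate_nonneg (Real.sqrt_nonneg _)) quarticRate_mul_lt_one).mul_const
      (√√(2 ^ n' / ε))
    rw [zero_mul] at h
    exact (h.eventually_lt_const (show (0 : ℝ) < δ / 2 by positivity)).exists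
  have hb := hM.typeAvg_indicator_le n' k hε
  have ha := hM.antitone_typeAvg hn'
  dsimp only at ha
  refine ⟨n' + k, Finset.univ.filter fun σ => ¬ ε / 2 ^ (n' + k) < M σ, ?_, ?_⟩
  · have hc : ((Finset.univ.filter fun σ : Fin (n' + k) → Fin 2 =>
        ¬ ε / 2 ^ (n' + k) < M σ).card : ℝ) / 2 ^ (n' + k) = 1 - typeAvg
        (fun σ : Fin (n' + k) → Fin 2 => if ε / 2 ^ (n' + k) < M σ then (1 : ℝ) else 0) := by
      rw [← typeAvg_one_sub, typeAvg, Finset.card_filter]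
      push_cast
      rw [div_eq_inv_mul, one_div]
      congr 1
      refine Finset.sum_congr rfl fun σ _ => ?_
      split_ifs <;> simp_all
    rw [hc]
    linarith
  · have h : ∀ σ ∈ Finset.univ.filter fun σ : Fin (n' + k) → Fin 2 =>
        ¬ ε / 2 ^ (n' + k) < M σ, M σ ≤ ε / 2 ^ (n' + k) := fun σ hσ =>
      not_lt.1 (Finset.mem_filter.1 hσ).2
    refine (Finset.sum_le_card_nsmul _ _ _ h).trans ?_
    have hcard : ((Finset.univ.filter fun σ : Fin (n' + k) → Fin 2 =>
        ¬ ε / 2 ^ (n' + k) < M σ).card : ℝ) ≤ 2 ^ (n' + k) := by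
      refine (Nat.cast_le.2 (Finset.card_filter_le _ _)).trans_eq ?_
      simp
    rw [nsmul_eq_mul]
    calc _ ≤ (2 : ℝ) ^ (n' + k) * (ε / 2 ^ (n' + k)) := by gcongr
      _ = ε := by field_simp

end ErasureDominated

/-! ### The compound bounds -/

namespace BMS

/-- The larger of the Bhattacharyya parameters of the tree channels of type `σ` over `P` and `Q`. -/
noncomputable def maxZ (P Q : BMS.{u}) {n : ℕ} (σ : Fin n → Fin 2) : ℝ :=
  max (P.tree σ).bhattacharyya (Q.tree σ).bhattacharyya

/-- The smaller of the capacities of the tree channels of type `σ` over `P` and `Q`. -/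
noncomputable def minI (P Q : BMS.{u}) {n : ℕ} (σ : Fin n → Fin 2) : ℝ :=
  min (P.tree σ).capacity (Q.tree σ).capacity

theorem erasureDominated_maxZ (P Q : BMS.{u}) : ErasureDominated (P.maxZ Q) where
  nonneg σ := le_max_of_le_left (P.tree σ).bhattacharyya_nonneg
  le_one σ := max_le (P.tree σ).bhattacharyya_le_one (Q.tree σ).bhattacharyya_le_one
  snoc_zero_le σ := by
    have hle : max (P.tree σ).bhattacharyya (Q.tree σ).bhattacharyya ≤ 1 :=
      max_le (P.tree σ).bhattacharyya_le_one (Q.tree σ).bhattacharyya_le_one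
    have hp := le_max_left (P.tree σ).bhattacharyya (Q.tree σ).bhattacharyya
    have hq := le_max_right (P.tree σ).bhattacharyya (Q.tree σ).bhattacharyya
    rw [maxZ, maxZ, tree_snoc_zero, tree_snoc_zero]
    refine max_le ((P.tree σ).bhattacharyya_check_le.trans ?_)
      ((Q.tree σ).bhattacharyya_check_le.trans ?_) <;> nlinarith
  snoc_one_le σ := by
    have hp0 := (P.tree σ).bhattacharyya_nonneg
    have hq0 := (Q.tree σ).bhattacharyya_nonneg
    rw [maxZ, maxZ, tree_snoc_one, tree_snoc_one, bhattacharyya_variableNode,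
      bhattacharyya_variableNode]
    exact max_le (pow_le_pow_left₀ hp0 (le_max_left _ _) 2)
      (pow_le_pow_left₀ hq0 (le_max_right _ _) 2)

theorem minI_nonneg (P Q : BMS.{u}) {n : ℕ} (σ : Fin n → Fin 2) : 0 ≤ P.minI Q σ :=
  le_min (P.tree σ).capacity_nonneg (Q.tree σ).capacity_nonneg

theorem antitone_typeAvg_minI (P Q : BMS.{u}) :
    Antitone fun n => typeAvg fun σ : Fin n → Fin 2 => P.minI Q σ := by
  refine antitone_nat_of_succ_le fun n => ?_
  rw [typeAvg_succ]
  refine typeAvg_mono fun σ => ?_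
  have hp := (P.tree σ).capacity_check_add_capacity_variableNode
  have hq := (Q.tree σ).capacity_check_add_capacity_variableNode
  simp only [minI, tree_snoc_zero, tree_snoc_one]
  refine le_min ?_ ?_
  · linarith [min_le_left (P.tree σ).check.capacity (Q.tree σ).check.capacity,
      min_le_left (P.tree σ).variableNode.capacity (Q.tree σ).variableNode.capacity]
  · linarith [min_le_right (P.tree σ).check.capacity (Q.tree σ).check.capacity,
      min_le_right (P.tree σ).variableNode.capacity (Q.tree σ).variableNode.capacity]

theorem one_sub_three_mul_maxZ_le_minI (P Q : BMS.{u}) {n : ℕ} (σ : Fin n → Fin 2) :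
    1 - 3 * P.maxZ Q σ ≤ P.minI Q σ := by
  have hp := le_max_left (P.tree σ).bhattacharyya (Q.tree σ).bhattacharyya
  have hq := le_max_right (P.tree σ).bhattacharyya (Q.tree σ).bhattacharyya
  rw [maxZ, minI]
  refine le_min ?_ ?_
  · linarith [(P.tree σ).one_sub_three_mul_bhattacharyya_le_capacity]
  · linarith [(Q.tree σ).one_sub_three_mul_bhattacharyya_le_capacity]

/-- The gap between the two bounds, type by type: the capacity of the channel with the larger
Bhattacharyya parameter `z` is at most `min 1 (3 (1 - z))`. -/
theorem minI_add_maxZ_sub_one_le (P Q : BMS.{u}) {n : ℕ} (σ : Fin n → Fin 2) :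
    P.minI Q σ + P.maxZ Q σ - 1 ≤ 3 * (P.maxZ Q σ * (1 - P.maxZ Q σ)) := by
  have key : ∀ W : BMS.{u}, W.capacity + W.bhattacharyya - 1 ≤
      3 * (W.bhattacharyya * (1 - W.bhattacharyya)) := fun W => by
    have h0 := W.bhattacharyya_nonneg
    have h1 := W.bhattacharyya_le_one
    have h2 := W.capacity_le_one
    have h3 := W.capacity_le_three_mul
    rcases le_total W.bhattacharyya (2 / 3) with h | h <;> nlinarith
  rcases le_total (P.tree σ).bhattacharyya (Q.tree σ).bhattacharyya with h | h
  · rw [maxZ, max_eq_right h, minI]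
    linarith [key (Q.tree σ), min_le_right (P.tree σ).capacity (Q.tree σ).capacity]
  · rw [maxZ, max_eq_left h, minI]
    linarith [key (P.tree σ), min_le_left (P.tree σ).capacity (Q.tree σ).capacity]

end BMS

/-- The rates whose supremum is the compound capacity of `P` and `Q`. -/
def achievableRates (P Q : BMS.{u}) : Set ℝ :=
  {R : ℝ | ∀ ε > 0, ∃ (n : ℕ) (A : Finset (Fin (2 ^ n))),
    R ≤ (A.card : ℝ) / 2 ^ n ∧ ∀ W ∈ ({P, Q} : Set BMS.{u}), W.blockError A ≤ ε}

theorem card_div_two_pow_le_one {n : ℕ} (A : Finset (Fin (2 ^ n))) : (A.card : ℝ) / 2 ^ n ≤ 1 := by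
  rw [div_le_one (by positivity)]
  refine (Nat.cast_le.2 A.card_le_univ).trans_eq ?_
  simp

theorem bddAbove_achievableRates (P Q : BMS.{u}) : BddAbove (achievableRates P Q) := by
  refine ⟨1, fun R hR => ?_⟩
  obtain ⟨n, A, h, -⟩ := hR 1 one_pos
  exact h.trans (card_div_two_pow_le_one A)

theorem mem_achievableRates (P Q : BMS.{u}) (n : ℕ) {R : ℝ}
    (hR : R < 1 - typeAvg fun σ : Fin n → Fin 2 => P.maxZ Q σ) : R ∈ achievableRates P Q := by
  intro ε hε
  obtain ⟨N, S, hS, hsum⟩ := (P.erasureDominated_maxZ Q).exists_good_types n (sub_pos.2 hR) hε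
  have hW : ∀ W : BMS.{u}, (∀ σ : Fin N → Fin 2, (W.tree σ).bhattacharyya ≤ P.maxZ Q σ) →
      W.blockError (S.map (bits N).symm.toEmbedding) ≤ ε := fun W h => by
    refine (W.blockError_le_sum_bhattacharyya _).trans ?_
    rw [Finset.sum_map]
    refine (Finset.sum_le_sum fun σ _ => ?_).trans hsum
    rw [Equiv.coe_toEmbedding, Equiv.apply_symm_apply]
    exact h σ
  refine ⟨N, S.map (bits N).symm.toEmbedding, ?_, ?_⟩
  · rw [Finset.card_map]
    linarith
  · rintro W (rfl | rfl)
    · exact hW _ fun σ => le_max_left _ _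
    · exact hW _ fun σ => le_max_right _ _

theorem one_sub_typeAvg_maxZ_le_compoundCapacity (P Q : BMS.{u}) (n : ℕ) :
    1 - typeAvg (fun σ : Fin n → Fin 2 => P.maxZ Q σ) ≤ compoundCapacity {P, Q} :=
  le_of_forall_lt fun _ hR => by
    obtain ⟨R', h1, h2⟩ := exists_between hR
    exact h1.trans_le (le_csSup (bddAbove_achievableRates P Q) (mem_achievableRates P Q n h2))

/-- Doubling the parameter `c` makes up for one more level of the tree: at a check node the
Bhattacharyya parameter at most doubles. -/
theorem typeAvg_max_one_sub_le {M : ∀ {n : ℕ}, (Fin n → Fin 2) → ℝ} (hM : ErasureDominated M)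
    (m k : ℕ) (c : ℝ) (hc : 0 ≤ c) :
    typeAvg (fun σ : Fin m → Fin 2 => max 0 (1 - 2 ^ k * c * M σ)) ≤
      typeAvg (fun σ : Fin (m + k) → Fin 2 => max 0 (1 - c * M σ)) := by
  induction k generalizing c with
  | zero => simp
  | succ k ih =>
    have h := ih (2 * c) (by positivity)
    rw [← mul_assoc, ← pow_succ] at h
    refine h.trans ?_
    change _ ≤ typeAvg (fun σ : Fin ((m + k) + 1) → Fin 2 => max 0 (1 - c * M σ))
    rw [typeAvg_succ]
    refine typeAvg_mono fun σ => ?_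
    have h0 := hM.nonneg σ
    have h1 := hM.le_one σ
    have key : ∀ z, z ≤ 2 * M σ → max 0 (1 - 2 * c * M σ) ≤ max 0 (1 - c * z) := fun z hz => by
      refine max_le_max le_rfl ?_
      nlinarith
    have e0 := key _ ((hM.snoc_zero_le σ).trans (by nlinarith))
    have e1 := key _ ((hM.snoc_one_le σ).trans (by nlinarith))
    linarith

/-- Converse bound. The length `m` of the types of a good code need not be comparable with `n`, so
the two are linked through types of length `m + n`: the average of `minI` only decreases from `n` to
`m + n`, and the descendants of good types of length `m` are still good after `n` more levels. -/
theorem card_div_le_typeAvg_minI (P Q : BMS.{u}) (n : ℕ) {m : ℕ} {A : Finset (Fin (2 ^ m))}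
    {ζ : ℝ} (hζ : 0 ≤ ζ) (hA : ∀ i ∈ A, P.maxZ Q (bits m i) ≤ ζ) :
    (A.card : ℝ) / 2 ^ m - 2 ^ n * 3 * ζ ≤ typeAvg fun σ : Fin n → Fin 2 => P.minI Q σ := by
  have hM := P.erasureDominated_maxZ Q
  have h1 : typeAvg (fun σ : Fin (m + n) → Fin 2 => P.minI Q σ) ≤
      typeAvg fun σ : Fin n → Fin 2 => P.minI Q σ :=
    P.antitone_typeAvg_minI Q (Nat.le_add_left n m)
  have h2 : typeAvg (fun σ : Fin (m + n) → Fin 2 => max 0 (1 - 3 * P.maxZ Q σ)) ≤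
      typeAvg fun σ : Fin (m + n) → Fin 2 => P.minI Q σ :=
    typeAvg_mono fun σ => max_le (P.minI_nonneg Q σ) (P.one_sub_three_mul_maxZ_le_minI Q σ)
  have h3 := typeAvg_max_one_sub_le hM m n 3 (by norm_num)
  refine le_trans ?_ (h3.trans (h2.trans h1))
  have h4 : (A.card : ℝ) / 2 ^ m =
      typeAvg fun σ : Fin m → Fin 2 => if (bits m).symm σ ∈ A then (1 : ℝ) else 0 := by
    rw [typeAvg, (bits m).symm.sum_comp fun i => if i ∈ A then (1 : ℝ) else 0]
    simp [div_eq_inv_mul]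
  rw [h4, ← typeAvg_const m (2 ^ n * 3 * ζ), ← typeAvg_sub]
  refine typeAvg_mono fun σ => ?_
  split_ifs with h
  · refine le_max_of_le_right ?_
    have := hA _ h
    rw [Equiv.apply_symm_apply] at this
    gcongr
  · refine le_max_of_le_left ?_
    have : 0 ≤ 2 ^ n * 3 * ζ := by positivity
    linarith

theorem compoundCapacity_le_typeAvg_minI (P Q : BMS.{u}) (n : ℕ) :
    compoundCapacity {P, Q} ≤ typeAvg fun σ : Fin n → Fin 2 => P.minI Q σ := by
  have hne : (achievableRates P Q).Nonempty := ⟨_, mem_achievableRates P Q 0 (sub_one_lt _)⟩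
  refine csSup_le hne fun R hR => le_of_forall_pos_le_add fun δ hδ => ?_
  set ζ : ℝ := δ / (2 ^ n * 3) with hζ
  have hζ0 : 0 < ζ := by positivity
  -- `l = 2 / ζ` and `ε = ζ ^ 2 / 4` balance the two terms of `l * ε + 1 / l`
  obtain ⟨m, A, hRA, hA⟩ := hR (ζ ^ 2 / 4) (by positivity)
  have hW : ∀ W ∈ ({P, Q} : Set BMS.{u}), ∀ i ∈ A, (W.tree (bits m i)).bhattacharyya ≤ ζ := by
    intro W hW i hi
    have hl : 0 < 2 / ζ := by positivity
    refine (W.bhattacharyya_le_of_blockError hi hl).trans ?_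
    calc 2 / ζ * W.blockError A + 1 / (2 / ζ) ≤ 2 / ζ * (ζ ^ 2 / 4) + 1 / (2 / ζ) := by
          gcongr
          exact hA W hW
      _ = ζ := by field_simp; norm_num
  have h := card_div_le_typeAvg_minI P Q n hζ0.le fun i hi =>
    max_le (hW P (by simp) i hi) (hW Q (by simp) i hi)
  have e : 2 ^ n * 3 * ζ = δ := by rw [hζ]; field_simp
  linarith

theorem tendsto_typeAvg_minI_sub (P Q : BMS.{u}) :
    Tendsto (fun n => typeAvg (fun σ : Fin n → Fin 2 => P.minI Q σ) -
      (1 - typeAvg fun σ : Fin n → Fin 2 => P.maxZ Q σ)) atTop (𝓝 0) := by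
  have h := ((P.erasureDominated_maxZ Q).tendsto_typeAvg_mul_one_sub).const_mul 3
  rw [mul_zero] at h
  refine squeeze_zero (fun n => ?_) (fun n => ?_) h
  · linarith [one_sub_typeAvg_maxZ_le_compoundCapacity P Q n,
      compoundCapacity_le_typeAvg_minI P Q n]
  · rw [← typeAvg_const_mul, ← typeAvg_one_sub, ← typeAvg_sub]
    exact typeAvg_mono fun σ => by linarith [P.minI_add_maxZ_sub_one_le Q σ]

theorem theorem1 (P Q : BMS.{u}) :
    (∀ n : ℕ, compoundCapacity {P, Q} ≤
      1 / 2 ^ n * ∑ σ : Fin n → Fin 2, min (P.tree σ).capacity (Q.tree σ).capacity) ∧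
    (∀ n : ℕ, 1 - 1 / 2 ^ n *
      ∑ σ : Fin n → Fin 2, max (P.tree σ).bhattacharyya (Q.tree σ).bhattacharyya ≤
        compoundCapacity {P, Q}) ∧
    Antitone (fun n : ℕ =>
      1 / 2 ^ n * ∑ σ : Fin n → Fin 2, min (P.tree σ).capacity (Q.tree σ).capacity) ∧
    Monotone (fun n : ℕ => 1 - 1 / 2 ^ n *
      ∑ σ : Fin n → Fin 2, max (P.tree σ).bhattacharyya (Q.tree σ).bhattacharyya) ∧
    Tendsto (fun n : ℕ =>
      1 / 2 ^ n * ∑ σ : Fin n → Fin 2, min (P.tree σ).capacity (Q.tree σ).capacity)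
      atTop (𝓝 (compoundCapacity {P, Q})) ∧
    Tendsto (fun n : ℕ => 1 - 1 / 2 ^ n *
      ∑ σ : Fin n → Fin 2, max (P.tree σ).bhattacharyya (Q.tree σ).bhattacharyya)
      atTop (𝓝 (compoundCapacity {P, Q})) := by
  have hU := compoundCapacity_le_typeAvg_minI P Q
  have hL := one_sub_typeAvg_maxZ_le_compoundCapacity P Q
  have hgap := tendsto_typeAvg_minI_sub P Q
  have hC : Tendsto (fun _ : ℕ => compoundCapacity {P, Q}) atTop (𝓝 (compoundCapacity {P, Q})) :=
    tendsto_const_nhds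
  refine ⟨hU, hL, P.antitone_typeAvg_minI Q, fun m n hmn => ?_, ?_, ?_⟩
  · exact sub_le_sub_left ((P.erasureDominated_maxZ Q).antitone_typeAvg hmn) 1
  · refine tendsto_of_tendsto_of_tendsto_of_le_of_le hC (by simpa using hC.add hgap) hU fun n => ?_
    change typeAvg (fun σ : Fin n → Fin 2 => P.minI Q σ) ≤ _
    linarith [hL n]
  · refine tendsto_of_tendsto_of_tendsto_of_le_of_le (by simpa using hC.sub hgap) hC
      (fun n => ?_) hL
    change _ ≤ 1 - typeAvg (fun σ : Fin n → Fin 2 => P.maxZ Q σ)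
    linarith [hU n]
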